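/- All vector spaces are over $\mathbb{C}$. Let $\hat{\mathfrak{sl}}_2=\mathfrak{sl}_2\otimes\mathbb{C}[t,t^{-1}]\oplus\mathbb{C}K$ be the affine Lie algebra with $K$ central and $[x_m,y_n]=[x,y]_{m+n}+m\,\delta_{m+n,0}\operatorname{tr}(xy)K$, where $x_n=x\otimes t^n$, and let $e,h,f$ be the standard basis of $\mathfrak{sl}_2$. For $k\in\mathbb{C}\setminus\{-2\}$ let $V^k(\mathfrak{sl}_2)$ be the universal affine vertex operator algebra of level $k$, i.e. the $\hat{\mathfrak{sl}}_2$-module induced from the one-dimensional module of $\mathfrak{sl}_2\otimes\mathbb{C}[t]\oplus\mathbb{C}K$ on which $\mathfrak{sl}_2\otimes\mathbb{C}[t]$ acts as $0$ and $K$ acts as $k$, with vacuum vector $\mathbf{1}$ and with the Sugawara operator $$L_0=\tfrac{1}{2(k+2)}\Big(e_0f_0+f_0e_0+\tfrac12h_0h_0+2\sum_{n>0}\big(e_{-n}f_n+f_{-n}e_n+\tfrac12h_{-n}h_n\big)\Big).$$ Let $\mathcal{L}=\bigoplus_{n\in\mathbb{Z}}\mathbb{C}L_n\oplus\mathbb{C}C$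 be the Virasoro algebra, with $C$ central and $[L_m,L_n]=(m-n)L_{m+n}+\frac{m^3-m}{12}\delta_{m+n,0}C$. For $c\in\mathbb{C}$ let $V_{\mathrm{Vir}}(c,0)$ be the universal Virasoro vertex operator algebra of central charge $c$, i.e. the quotient of the Verma module of $\mathcal{L}$ of central charge $c$ and highest $L_0$-weight $0$ by the submodule generated by $L_{-1}\mathbf{1}$, where $\mathbf{1}$ is the highest-weight vector. Let $k\in\mathbb{C}\setminus\{-2\}$ and $c\in\mathbb{C}$. For each choice of sign there is a unique linear map $\psi^\pm\colon V^k(\mathfrak{sl}_2)\to V_{\mathrm{Vir}}(c,0)$ with $$\prod_{i=1}^\infty(e_{-i})^{k_i}(h_{-i})^{l_i}(f_{-i})^{m_i}\mathbf{1}\;\longmapsto\;\prod_{i=1}^\infty(L_{-3i\pm1})^{k_i}(L_{-3i})^{l_i}(L_{-3i\mp1})^{m_i}\mathbf{1}$$ for all finitely supported sequences $(k_i)_{i\ge1},(l_i)_{i\ge1},(m_i)_{i\ge1}$ in $\mathbb{Z}_{\ge0}$ (the factors being ordered by increasing $i$ from left to right). It is a linear isomorphism, and it maps every vector of $h_0$-weight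 $f$ and $L_0$-weight $n$ to a vector of $L_0$-weight $\mp f/2+3n$. On $V^k(\mathfrak{sl}_2)$ the operators $h_0$ and $L_0$ commute and act semisimply with finite-dimensional simultaneous eigenspaces, on $V_{\mathrm{Vir}}(c,0)$ the operator $L_0$ acts semisimply with finite-dimensional eigenspaces, and in both cases the $L_0$-eigenvalues are bounded from below. Hence the formal characters $\operatorname{ch}^*_{V^k(\mathfrak{sl}_2)}(w,q)=\operatorname{tr}q^{L_0}w^{h_0}$ and $\operatorname{ch}^*_{V_{\mathrm{Vir}}(c,0)}(q)=\operatorname{tr}q^{L_0}$ are defined. The substitution $w\mapsto q^{\mp1/2}$, $q\mapsto q^3$ is defined for the former (every power of $q$ receives only finitely many contributions), and $$\operatorname{ch}^*_{V^k(\mathfrak{sl}_2)}(q^{\mp1/2},q^3)=\operatorname{ch}^*_{V_{\mathrm{Vir}}(c,0)}(q).$$ -/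

import Mathlib

noncomputable section

open scoped TensorProduct

/-! ### The affine Lie algebra of `sl₂` -/

namespace AffineSl2

/-- The Lie algebra `sl₂` of traceless complex `2 × 2` matrices. -/
abbrev Sl2 : Type := LieAlgebra.SpecialLinear.sl (Fin 2) ℂ

/-- The element `e` of the standard `sl₂`-triple. -/
def e : Sl2 := LieAlgebra.SpecialLinear.single 0 1 (by decide) 1

/-- The element `h` of the standard `sl₂`-triple. -/
def h : Sl2 := LieAlgebra.SpecialLinear.singleSubSingle 0 1 1

/-- The element `f` of the standard `sl₂`-triple. -/
def f : Sl2 := LieAlgebra.SpecialLinear.single 1 0 (by decide) 1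

/-- The normalised invariant form `(x, y) = tr (x y)` on `sl₂`. -/
def form : LinearMap.BilinForm ℂ Sl2 :=
  LinearMap.mk₂ ℂ (fun x y => Matrix.trace (x.val * y.val))
    (by intros; simp [add_mul]) (by intros; simp)
    (by intros; simp [mul_add]) (by intros; simp)

lemma form_apply (x y : Sl2) : form x y = Matrix.trace (x.val * y.val) := rfl

lemma form_isSymm : form.IsSymm :=
  ⟨fun x y => by simp [form_apply, Matrix.trace_mul_comm x.val]⟩

lemma form_lieInvariant : form.lieInvariant Sl2 := by
  intro x y z
  simp only [form_apply, LieAlgebra.SpecialLinear.sl_bracket, sub_mul, mul_sub, Matrix.trace_sub,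
    neg_sub]
  rw [Matrix.mul_assoc y.val, Matrix.mul_assoc x.val, Matrix.trace_mul_comm x.val,
    Matrix.mul_assoc y.val]

/-- The loop algebra `sl₂ ⊗ ℂ[t, t⁻¹]`. -/
abbrev Loop : Type := LieAlgebra.loopAlgebra ℂ ℤ Sl2

/-- The cocycle `(x tᵐ, y tⁿ) ↦ m δ_{m+n,0} (x, y)`. The cocycle from the library is
`(x tᵐ, y tⁿ) ↦ n δ_{m+n,0} Φ(x, y)`, whence the choice `Φ = -(·, ·)`. -/
def cocycle : LieModule.Cohomology.twoCocycle ℂ Loop (TrivialLieModule ℂ Loop ℂ) :=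
  LieAlgebra.LoopAlgebra.twoCocycleOfBilinear ℂ ℤ Sl2 (-form)
    (fun x y z => by simp [form_lieInvariant x y z]) ⟨fun x y => by simp [form_isSymm.eq x y]⟩

/-- The affine Lie algebra `sl₂ ⊗ ℂ[t, t⁻¹] ⊕ ℂ K`. -/
abbrev AffineLie : Type := LieAlgebra.ofTwoCocycle cocycle

/-- The element `xₙ = x ⊗ tⁿ`. -/
def mode (x : Sl2) (n : ℤ) : AffineLie :=
  LieAlgebra.ofProd cocycle ((AddMonoidAlgebra.single n 1 : AddMonoidAlgebra ℂ ℤ) ⊗ₜ[ℂ] x, 0)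

/-- The central element. -/
def K : AffineLie :=
  LieAlgebra.ofProd cocycle (0, (TrivialLieModule.equiv ℂ Loop ℂ).symm 1)

lemma residuePairing_single (x y : Sl2) (m n : ℤ) :
    LieAlgebra.LoopAlgebra.residuePairing ℂ ℤ Sl2 (-form)
      ((AddMonoidAlgebra.single m 1 : AddMonoidAlgebra ℂ ℤ) ⊗ₜ[ℂ] x)
      ((AddMonoidAlgebra.single n 1 : AddMonoidAlgebra ℂ ℤ) ⊗ₜ[ℂ] y) =
      if m + n = 0 then (m : ℂ) * form x y else 0 := by
  simp only [LieAlgebra.LoopAlgebra.residuePairing_apply_apply,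
    LieAlgebra.LoopAlgebra.toFinsupp_single_tmul]
  rw [Finsupp.sum_single_index (by simp), Finsupp.single_apply]
  by_cases hmn : m + n = 0
  · obtain rfl : m = -n := by lia
    simp
  · rw [if_neg (by lia), if_neg hmn]
    simp

lemma mode_lie_mode (x y : Sl2) (m n : ℤ) :
    ⁅mode x m, mode y n⁆ =
      mode ⁅x, y⁆ (m + n) + (if m + n = 0 then (m : ℂ) * form x y else 0) • K := by
  rw [LieAlgebra.bracket_ofTwoCocycle]
  have hc : ∀ a b : Loop, (cocycle : Loop →ₗ[ℂ] Loop →ₗ[ℂ] TrivialLieModule ℂ Loop ℂ) a b =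
      (TrivialLieModule.equiv ℂ Loop ℂ).symm
        (LieAlgebra.LoopAlgebra.residuePairing ℂ ℤ Sl2 (-form) a b) := fun a b => rfl
  simp only [hc, mode, K, Equiv.symm_apply_apply, ← LieAlgebra.of_smul, ← LieAlgebra.of_add,
    trivial_lie_zero, residuePairing_single]
  refine congrArg _ (Prod.ext ?_ ?_)
  · simp only [Prod.fst_add, Prod.smul_fst, smul_zero, add_zero,
      LieAlgebra.ExtendScalars.bracket_tmul, AddMonoidAlgebra.single_mul_single, mul_one]
  · simp only [Prod.snd_add, Prod.smul_snd, add_zero, sub_zero, zero_add, ← map_smul, smul_eq_mul,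
      mul_one]

lemma lie_K (x : AffineLie) : ⁅x, K⁆ = 0 := by
  rw [LieAlgebra.bracket_ofTwoCocycle, ← LieAlgebra.of_zero]
  refine congrArg _ ?_
  simp [K, trivial_lie_zero]

lemma affine_induction {p : AffineLie → Prop} (hm : ∀ x n, p (mode x n)) (hK : p K)
    (hadd : ∀ a b, p a → p b → p (a + b)) (hsmul : ∀ (c : ℂ) a, p a → p (c • a)) (a : AffineLie) :
    p a := by
  have h0 : p 0 := by simpa using hsmul 0 _ hK
  have h1 : ∀ l : Loop, p (LieAlgebra.ofProd cocycle (l, 0)) := by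
    intro l
    induction l using TensorProduct.induction_on with
    | zero => exact h0
    | add a b ha hb => simpa [← LieAlgebra.of_add] using hadd _ _ ha hb
    | tmul a x =>
      induction a using AddMonoidAlgebra.induction_linear with
      | zero => rw [TensorProduct.zero_tmul]; exact h0
      | add a b ha hb =>
        rw [TensorProduct.add_tmul]; simpa [← LieAlgebra.of_add] using hadd _ _ ha hb
      | single n r =>
        have := hsmul r _ (hm x n)
        rwa [mode, ← LieAlgebra.of_smul, Prod.smul_mk, smul_zero, TensorProduct.smul_tmul',
          AddMonoidAlgebra.smul_single, smul_eq_mul, mul_one] at this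
  obtain ⟨⟨l, z⟩⟩ := a
  have h2 := hadd _ _ (h1 l) (hsmul (TrivialLieModule.equiv ℂ Loop ℂ z) _ hK)
  convert h2 using 1
  rw [K, ← LieAlgebra.of_smul, ← LieAlgebra.of_add]
  change LieAlgebra.ofProd cocycle (l, z) = _
  refine congrArg _ ?_
  ext1
  · simp
  · simp [← map_smul]

end AffineSl2

/-! ### The universal affine vertex operator algebra of `sl₂` -/

namespace AffineSl2

section

attribute [local instance 100] LieRing.ofAssociativeRing

/-- The universal enveloping algebra of the affine Lie algebra. -/
abbrev U : Type := UniversalEnvelopingAlgebra ℂ AffineLie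

/-- The image of `xₙ` in the universal enveloping algebra. -/
def u (x : Sl2) (n : ℤ) : U := UniversalEnvelopingAlgebra.ι ℂ (mode x n)

/-- The left ideal generated by `sl₂ ⊗ ℂ[t]` and `K - k`. -/
def vacuumIdeal (k : ℂ) : Ideal U :=
  Ideal.span ({a | ∃ (x : Sl2) (n : ℤ), 0 ≤ n ∧ a = u x n} ∪
    {UniversalEnvelopingAlgebra.ι ℂ K - algebraMap ℂ U k})

/-- The vacuum module `V^k(sl₂)`: the module induced from the one-dimensional module of
`sl₂ ⊗ ℂ[t] ⊕ ℂ K` on which `sl₂ ⊗ ℂ[t]` acts by zero and `K` acts by `k`. -/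
abbrev UniversalVOA (k : ℂ) : Type := U ⧸ vacuumIdeal k

/-- The vacuum vector. -/
def vacuum (k : ℂ) : UniversalVOA k := Submodule.Quotient.mk 1

/-- The action of an element of the enveloping algebra as a `ℂ`-linear operator. -/
def op (k : ℂ) : U →ₐ[ℂ] Module.End ℂ (UniversalVOA k) := Algebra.lsmul ℂ ℂ (UniversalVOA k)

lemma op_apply (k : ℂ) (a : U) (v : UniversalVOA k) : op k a v = a • v := rfl

lemma u_smul_vacuum (k : ℂ) (x : Sl2) {n : ℤ} (hn : 0 ≤ n) : u x n • vacuum k = 0 := by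
  rw [vacuum, ← Submodule.Quotient.mk_smul, Submodule.Quotient.mk_eq_zero, smul_eq_mul, mul_one]
  exact Ideal.subset_span (Or.inl ⟨x, n, hn, rfl⟩)

lemma u_mul_u (x y : Sl2) (m n : ℤ) :
    u x m * u y n = u y n * u x m + u ⁅x, y⁆ (m + n) +
      (if m + n = 0 then (m : ℂ) * form x y else 0) • UniversalEnvelopingAlgebra.ι ℂ K := by
  have := congrArg (UniversalEnvelopingAlgebra.ι ℂ) (mode_lie_mode x y m n)
  rw [LieHom.map_lie, map_add, map_smul, LieRing.of_associative_ring_bracket,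
    sub_eq_iff_eq_add] at this
  rw [u, u, u, this]
  abel

lemma u_mul_K (x : Sl2) (n : ℤ) :
    u x n * UniversalEnvelopingAlgebra.ι ℂ K = UniversalEnvelopingAlgebra.ι ℂ K * u x n := by
  have := congrArg (UniversalEnvelopingAlgebra.ι ℂ) (lie_K (mode x n))
  rwa [LieHom.map_lie, map_zero, LieRing.of_associative_ring_bracket, sub_eq_zero] at this

lemma U_adjoin : Algebra.adjoin ℂ (Set.range (UniversalEnvelopingAlgebra.ι ℂ (L := AffineLie))) =
    ⊤ := by
  set S := Algebra.adjoin ℂ (Set.range (UniversalEnvelopingAlgebra.ι ℂ (L := AffineLie))) with hS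
  let g : AffineLie →ₗ⁅ℂ⁆ S :=
    { toFun := fun x => ⟨UniversalEnvelopingAlgebra.ι ℂ x, Algebra.subset_adjoin ⟨x, rfl⟩⟩
      map_add' := fun x y => Subtype.ext (map_add _ x y)
      map_smul' := fun c x => Subtype.ext (map_smul _ c x)
      map_lie' := fun {x y} => Subtype.ext (LieHom.map_lie _ x y) }
  have hid : S.val.comp (UniversalEnvelopingAlgebra.lift ℂ g) = AlgHom.id ℂ U := by
    refine UniversalEnvelopingAlgebra.hom_ext ℂ (LieHom.ext fun x => ?_)
    change ((UniversalEnvelopingAlgebra.lift ℂ g (UniversalEnvelopingAlgebra.ι ℂ x) : S) : U) = _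
    rw [UniversalEnvelopingAlgebra.lift_ι_apply]
    rfl
  refine eq_top_iff.mpr fun a _ => ?_
  have := congrArg (fun φ : U →ₐ[ℂ] U => φ a) hid
  change ((UniversalEnvelopingAlgebra.lift ℂ g a : S) : U) = a at this
  rw [← this]
  exact Subtype.property _

/-- The vectors killed by all `xₙ` with `n` large. -/
def smoothPart (k : ℂ) : Submodule ℂ (UniversalVOA k) where
  carrier := {v | ∃ N : ℕ, ∀ n : ℤ, N ≤ n → ∀ x, u x n • v = 0}
  add_mem' := by
    rintro v w ⟨N, hN⟩ ⟨M, hM⟩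
    refine ⟨max N M, fun n hn x => ?_⟩
    push_cast at hn
    rw [smul_add, hN n (by lia), hM n (by lia), add_zero]
  zero_mem' := ⟨0, fun n _ x => smul_zero _⟩
  smul_mem' := by
    rintro c v ⟨N, hN⟩
    exact ⟨N, fun n hn x => by rw [smul_comm, hN n hn, smul_zero]⟩

lemma smul_mem_smoothPart (k : ℂ) (a : U) {v : UniversalVOA k} (hv : v ∈ smoothPart k) :
    a • v ∈ smoothPart k := by
  have ha : a ∈ Algebra.adjoin ℂ
      (Set.range (UniversalEnvelopingAlgebra.ι ℂ (L := AffineLie))) := by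
    rw [U_adjoin]; trivial
  induction ha using Algebra.adjoin_induction generalizing v with
  | algebraMap c => rw [algebraMap_smul]; exact Submodule.smul_mem _ c hv
  | add a b _ _ ha hb => rw [add_smul]; exact Submodule.add_mem _ (ha hv) (hb hv)
  | mul a b _ _ ha hb => rw [mul_smul]; exact ha (hb hv)
  | mem a ha =>
    obtain ⟨z, rfl⟩ := ha
    induction z using affine_induction with
    | hm y m =>
      obtain ⟨N, hN⟩ := hv
      refine ⟨N + m.natAbs + 1, fun n hn x => ?_⟩
      have h1 := hN n (by omega) x
      have h2 := hN (n + m) (by omega) ⁅x, y⁆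
      change u x n • u y m • v = 0
      rw [← mul_smul, u_mul_u, if_neg (by omega), zero_smul, add_zero, add_smul, mul_smul, h1, h2,
        smul_zero, add_zero]
    | hK =>
      obtain ⟨N, hN⟩ := hv
      refine ⟨N, fun n hn x => ?_⟩
      rw [← mul_smul, u_mul_K, mul_smul, hN n hn, smul_zero]
    | hadd a b ha hb => rw [map_add, add_smul]; exact Submodule.add_mem _ ha hb
    | hsmul c a ha => rw [map_smul, smul_assoc]; exact Submodule.smul_mem _ c ha

lemma mem_smoothPart (k : ℂ) (v : UniversalVOA k) : v ∈ smoothPart k := by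
  obtain ⟨a, rfl⟩ := Submodule.Quotient.mk_surjective _ v
  have : (Submodule.Quotient.mk a : UniversalVOA k) = a • vacuum k := by
    rw [vacuum, ← Submodule.Quotient.mk_smul, smul_eq_mul, mul_one]
  rw [this]
  exact smul_mem_smoothPart k a ⟨0, fun n hn x => u_smul_vacuum k x (by simpa using hn)⟩

end

/-- The element `e₋ₙ fₙ + f₋ₙ eₙ + (1/2) h₋ₙ hₙ` of the enveloping algebra. The bases `(e, f, h)`
and `(f, e, h/2)` of `sl₂` are dual with respect to `form`. -/
def casimirTerm (n : ℕ) : U :=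
  u e (-n) * u f n + u f (-n) * u e n + (1 / 2 : ℂ) • (u h (-n) * u h n)

lemma finite_casimirTerm (k : ℂ) (v : UniversalVOA k) :
    (Function.support fun n : ℕ => casimirTerm (n + 1) • v).Finite := by
  obtain ⟨N, hN⟩ := mem_smoothPart k v
  refine (Set.finite_lt_nat N).subset fun n hn => ?_
  by_contra hlt
  have hle : (N : ℤ) ≤ ((n + 1 : ℕ) : ℤ) := by
    have : N ≤ n := not_lt.mp hlt
    push_cast; lia
  refine hn ?_
  simp only [casimirTerm, add_smul, smul_assoc, mul_smul, hN _ hle, smul_zero, add_zero]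

/-- The operator `h₀`. -/
def h0 (k : ℂ) : Module.End ℂ (UniversalVOA k) := op k (u h 0)

/-- The Sugawara operator
`L₀ = 1/(2(k+2)) (e₀f₀ + f₀e₀ + h₀h₀/2 + 2 ∑_{n>0} (e₋ₙfₙ + f₋ₙeₙ + h₋ₙhₙ/2))`. On each vector only
finitely many terms of the sum are nonzero. -/
def L0 (k : ℂ) : Module.End ℂ (UniversalVOA k) :=
  (1 / (2 * (k + 2))) • (op k (casimirTerm 0) + (2 : ℂ) •
    { toFun := fun v => ∑ᶠ n : ℕ, casimirTerm (n + 1) • v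
      map_add' := fun v w => by
        simp only [smul_add]
        exact finsum_add_distrib (finite_casimirTerm k v) (finite_casimirTerm k w)
      map_smul' := fun c v => by
        simp only [smul_comm _ c v, RingHom.id_apply]
        exact (smul_finsum' c (finite_casimirTerm k v)).symm })

/-- The vector `∏_{i=1}^N (e₋ᵢ)^(aᵢ) (h₋ᵢ)^(bᵢ) (f₋ᵢ)^(dᵢ) 𝟏`, the factors being ordered by
increasing `i` from left to right. -/
def monomial (k : ℂ) (N : ℕ) (a b d : ℕ → ℕ) : UniversalVOA k :=
  ((List.range' 1 N).map fun i : ℕ =>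
    u e (-i) ^ a i * u h (-i) ^ b i * u f (-i) ^ d i).prod • vacuum k

end AffineSl2

/-! ### The Virasoro algebra -/

/-- The Virasoro algebra `⨁ ℂ Lₙ ⊕ ℂ C`. -/
def Virasoro : Type := (ℤ →₀ ℂ) × ℂ

namespace Virasoro

instance : AddCommGroup Virasoro := inferInstanceAs (AddCommGroup ((ℤ →₀ ℂ) × ℂ))

instance : Module ℂ Virasoro := inferInstanceAs (Module ℂ ((ℤ →₀ ℂ) × ℂ))

/-- The basis element `Lₙ`. -/
def L (n : ℤ) : Virasoro := (Finsupp.single n 1, 0)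

/-- The central element. -/
def C : Virasoro := (0, 1)

/-- The bilinear map on `⨁ ℂ Lₙ` with
`(Lₘ, Lₙ) ↦ (m - n) Lₘ₊ₙ + (m³ - m)/12 δ_{m+n,0} C`. -/
def wittBracket : (ℤ →₀ ℂ) →ₗ[ℂ] (ℤ →₀ ℂ) →ₗ[ℂ] Virasoro :=
  Finsupp.lift _ ℂ ℤ fun m => Finsupp.lift _ ℂ ℤ fun n =>
    ((m : ℂ) - n) • L (m + n) + (if m + n = 0 then ((m : ℂ) ^ 3 - m) / 12 else 0) • C

instance : Bracket Virasoro Virasoro := ⟨fun a b => wittBracket a.1 b.1⟩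

lemma lie_def (a b : Virasoro) : ⁅a, b⁆ = wittBracket a.1 b.1 := rfl

lemma wittBracket_single (m n : ℤ) :
    wittBracket (Finsupp.single m 1) (Finsupp.single n 1) =
    ((m : ℂ) - n) • L (m + n) + (if m + n = 0 then ((m : ℂ) ^ 3 - m) / 12 else 0) • C := by
  simp [wittBracket]

lemma hom_ext {M : Type*} [AddCommGroup M] [Module ℂ M] {φ ψ : (ℤ →₀ ℂ) →ₗ[ℂ] M}
    (hyp : ∀ n, φ (Finsupp.single n 1) = ψ (Finsupp.single n 1)) : φ = ψ :=
  Finsupp.lhom_ext' fun n => LinearMap.ext_ring (hyp n)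

/-- The projection of the Virasoro algebra onto `⨁ ℂ Lₙ`. -/
def fstHom : Virasoro →ₗ[ℂ] (ℤ →₀ ℂ) := LinearMap.fst ℂ (ℤ →₀ ℂ) ℂ

lemma fstHom_L (n : ℤ) : fstHom (L n) = Finsupp.single n 1 := rfl

lemma fstHom_C : fstHom C = 0 := rfl

lemma wittBracket_skew (a b : ℤ →₀ ℂ) : wittBracket a b = -wittBracket b a := by
  suffices wittBracket = -wittBracket.flip from congrArg (fun φ => φ a b) this
  refine hom_ext fun m => hom_ext fun n => ?_
  rw [LinearMap.neg_apply, LinearMap.neg_apply, LinearMap.flip_apply, wittBracket_single,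
    wittBracket_single, add_comm n m]
  by_cases hmn : m + n = 0
  · obtain rfl : n = -m := by lia
    simp only [hmn, if_true]
    push_cast
    module
  · simp only [hmn, if_false]
    module

lemma wittBracket_self (a : ℤ →₀ ℂ) : wittBracket a a = 0 := by
  have h2 : (2 : ℂ) • wittBracket a a = 0 := by
    rw [two_smul]
    nth_rewrite 1 [wittBracket_skew]
    exact neg_add_cancel _
  simpa using h2

lemma wittBracket_jacobi (a b c : ℤ →₀ ℂ) :
    wittBracket a (wittBracket b c).1 =
      wittBracket (wittBracket a b).1 c + wittBracket b (wittBracket a c).1 := by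
  have key : ∀ m n p : ℤ,
      wittBracket (Finsupp.single m 1) (fstHom (wittBracket (Finsupp.single n 1)
        (Finsupp.single p 1))) =
      wittBracket (fstHom (wittBracket (Finsupp.single m 1) (Finsupp.single n 1)))
        (Finsupp.single p 1) +
      wittBracket (Finsupp.single n 1) (fstHom (wittBracket (Finsupp.single m 1)
        (Finsupp.single p 1))) := by
    intro m n p
    simp only [wittBracket_single, map_add, map_smul, fstHom_L, fstHom_C, smul_zero, add_zero,
      LinearMap.smul_apply]
    rw [show m + (n + p) = m + n + p by ring, show n + (m + p) = m + n + p by ring]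
    by_cases hs : m + n + p = 0
    · obtain rfl : p = -m - n := by lia
      simp only [hs, if_true]
      push_cast
      module
    · simp only [hs, if_false]
      push_cast
      module
  change wittBracket a (fstHom (wittBracket b c)) =
      wittBracket (fstHom (wittBracket a b)) c + wittBracket b (fstHom (wittBracket a c))
  induction a using Finsupp.induction_linear with
  | zero => simp
  | add a a' h h' => simp only [map_add, LinearMap.add_apply, h, h']; abel
  | single m r =>
  induction b using Finsupp.induction_linear with
  | zero => simp
  | add b b' h h' => simp only [map_add, LinearMap.add_apply, h, h']; abel
  | single n s =>
  induction c using Finsupp.induction_linear with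
  | zero => simp
  | add c c' h h' => simp only [map_add, h, h']; abel
  | single p t =>
    have := congrArg (fun v => (r * s * t) • v) (key m n p)
    rw [← mul_one r, ← mul_one s, ← mul_one t, ← smul_eq_mul r, ← smul_eq_mul s, ← smul_eq_mul t,
      ← Finsupp.smul_single, ← Finsupp.smul_single, ← Finsupp.smul_single]
    simp only [map_smul, LinearMap.smul_apply, smul_smul]
    rw [smul_add] at this
    convert this using 2 <;> ring_nf

instance : LieRing Virasoro where
  add_lie a b c := by
    change wittBracket (a.1 + b.1) c.1 = _
    rw [map_add]; rfl
  lie_add a b c := by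
    change wittBracket a.1 (b.1 + c.1) = _
    rw [map_add]; rfl
  lie_self a := wittBracket_self a.1
  leibniz_lie a b c := wittBracket_jacobi a.1 b.1 c.1

instance : LieAlgebra ℂ Virasoro where
  lie_smul t a b := by
    change wittBracket a.1 (t • b.1) = _
    rw [map_smul]; rfl

lemma L_lie_L (m n : ℤ) :
    ⁅L m, L n⁆ =
      ((m : ℂ) - n) • L (m + n) + (if m + n = 0 then ((m : ℂ) ^ 3 - m) / 12 else 0) • C :=
  wittBracket_single m n

/-! ### The universal Virasoro vertex operator algebra -/

/-- The universal enveloping algebra of the Virasoro algebra. -/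
abbrev U : Type := UniversalEnvelopingAlgebra ℂ Virasoro

/-- The image of `Lₙ` in the universal enveloping algebra. -/
def u (n : ℤ) : U := UniversalEnvelopingAlgebra.ι ℂ (L n)

/-- The left ideal generated by `Lₙ` for `n > 0`, `L₀ - h` and `C - c`. -/
def vermaIdeal (c h : ℂ) : Ideal U :=
  Ideal.span ({a | ∃ n : ℤ, 0 < n ∧ a = u n} ∪
    {u 0 - algebraMap ℂ U h, UniversalEnvelopingAlgebra.ι ℂ C - algebraMap ℂ U c})

/-- The Verma module of central charge `c` and highest weight `h`. -/
abbrev Verma (c h : ℂ) : Type := U ⧸ vermaIdeal c h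

/-- The highest-weight vector. -/
def highestWeightVector (c h : ℂ) : Verma c h := Submodule.Quotient.mk 1

/-- The submodule of the Verma module of highest weight `0` generated by `L₋₁ 𝟏`. -/
def singularSubmodule (c : ℂ) : Submodule U (Verma c 0) :=
  Submodule.span U {u (-1) • highestWeightVector c 0}

/-- The universal Virasoro vertex operator algebra `V_Vir(c, 0)`, that is, the quotient of the
Verma module of highest weight `0` by the submodule generated by `L₋₁ 𝟏`. -/
abbrev UniversalVOA (c : ℂ) : Type := Verma c 0 ⧸ singularSubmodule c

/-- The vacuum vector. -/
def vacuum (c : ℂ) : UniversalVOA c := Submodule.Quotient.mk (highestWeightVector c 0)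

/-- The action of an element of the enveloping algebra as a `ℂ`-linear operator. -/
def op (c : ℂ) : U →ₐ[ℂ] Module.End ℂ (UniversalVOA c) := Algebra.lsmul ℂ ℂ (UniversalVOA c)

/-- The operator `L₀`. -/
def L0 (c : ℂ) : Module.End ℂ (UniversalVOA c) := op c (u 0)

/-- The vector `∏_{i=1}^N (L_{-3i+ε})^(aᵢ) (L_{-3i})^(bᵢ) (L_{-3i-ε})^(dᵢ) 𝟏`, the factors being
ordered by increasing `i` from left to right. -/
def monomial (c : ℂ) (ε : ℤˣ) (N : ℕ) (a b d : ℕ → ℕ) : UniversalVOA c :=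
  ((List.range' 1 N).map fun i : ℕ =>
    u (-3 * i + ε) ^ a i * u (-3 * i) ^ b i * u (-3 * i - ε) ^ d i).prod • vacuum c

end Virasoro

/-! ### Formal characters -/

namespace FormalCharacter

variable {V : Type*} [AddCommGroup V] [Module ℂ V]

/-- The simultaneous eigenspace of `H` and `L` for the eigenvalues `(f, n)`. -/
def weightSpace (H L : Module.End ℂ V) (p : ℂ × ℂ) : Submodule ℂ V :=
  Module.End.eigenspace H p.1 ⊓ Module.End.eigenspace L p.2

/-- The formal character `tr q^L` is well defined: `L` acts semisimply with finite-dimensional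
eigenspaces and eigenvalues bounded from below. -/
structure HasChar (L : Module.End ℂ V) : Prop where
  isInternal : DirectSum.IsInternal fun n : ℂ => Module.End.eigenspace L n
  finite : ∀ n : ℂ, FiniteDimensional ℂ (Module.End.eigenspace L n)
  bounded : ∃ B : ℝ, ∀ n : ℂ, Module.End.HasEigenvalue L n → B ≤ n.re

/-- The formal Jacobi character `tr q^L w^H` is well defined: `H` and `L` commute and act
semisimply with finite-dimensional simultaneous eigenspaces, and the eigenvalues of `L` are
bounded from below. -/
structure HasJacobiChar (H L : Module.End ℂ V) : Prop where
  commute : Commute H L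
  isInternal : DirectSum.IsInternal (weightSpace H L)
  finite : ∀ p : ℂ × ℂ, FiniteDimensional ℂ (weightSpace H L p)
  bounded : ∃ B : ℝ, ∀ n : ℂ, Module.End.HasEigenvalue L n → B ≤ n.re

/-- The formal character `tr q^L`, given by its coefficients: the coefficient of `q^n`. -/
def char (L : Module.End ℂ V) (n : ℂ) : ℕ := Module.finrank ℂ (Module.End.eigenspace L n)

/-- The formal Jacobi character `tr q^L w^H`, given by its coefficients: the coefficient of
`w^f q^n` at `(f, n)`. -/
def jacobiChar (H L : Module.End ℂ V) (p : ℂ × ℂ) : ℕ := Module.finrank ℂ (weightSpace H L p)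

/-- The substitution `w ↦ q^a`, `q ↦ q^b` in the formal series `∑ X(f, n) w^f q^n` is defined:
each power of `q` receives only finitely many contributions. -/
def CanSubst (X : ℂ × ℂ → ℕ) (a b : ℂ) : Prop :=
  ∀ m : ℂ, {p : ℂ × ℂ | a * p.1 + b * p.2 = m ∧ X p ≠ 0}.Finite

/-- The formal series in `q` obtained from `∑ X(f, n) w^f q^n` by `w ↦ q^a`, `q ↦ q^b`. -/
def subst (X : ℂ × ℂ → ℕ) (a b : ℂ) (m : ℂ) : ℕ :=
  ∑ᶠ p ∈ {p : ℂ × ℂ | a * p.1 + b * p.2 = m}, X p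

end FormalCharacter

end

noncomputable section

namespace InducedModule

open Sum

variable {R L ι β : Type*} [CommRing R] [LieRing L] [LieAlgebra R L]

/-- The free module on the multisets in `ι`, that is, on the ordered monomials. -/
abbrev Mon (R ι : Type*) [CommRing R] : Type _ := Multiset ι →₀ R

/-- The basis vector given by a multiset. -/
abbrev z (R : Type*) {ι : Type*} [CommRing R] (A : Multiset ι) : Mon R ι := Finsupp.single A 1

/-- The leading term of the action of the basis element `i` on `z A`. -/
def top (R : Type*) [CommRing R] (i : ι ⊕ β) (A : Multiset ι) : Mon R ι :=
  Sum.elim (fun j => z R (j ::ₘ A)) (fun _ => 0) i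

/-- The span of the monomials of length at most `n`. -/
def filtration (R ι : Type*) [CommRing R] (n : ℕ) : Submodule R (Mon R ι) :=
  Finsupp.supported R R {A | A.card ≤ n}

lemma filtration_mono {m n : ℕ} (h : m ≤ n) : filtration R ι m ≤ filtration R ι n :=
  Finsupp.supported_mono fun _ hA => le_trans hA h

lemma z_mem_filtration {A : Multiset ι} {n : ℕ} (h : A.card ≤ n) :
    z R A ∈ filtration R ι n :=
  Finsupp.single_mem_supported R 1 h

lemma filtration_induction {n : ℕ} {p : Mon R ι → Prop}
    (hz : ∀ A : Multiset ι, A.card ≤ n → p (z R A)) (h0 : p 0)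
    (hadd : ∀ v w, p v → p w → p (v + w)) (hsmul : ∀ (r : R) v, p v → p (r • v))
    {v : Mon R ι} (hv : v ∈ filtration R ι n) : p v := by
  rw [filtration, Finsupp.supported_eq_span_single] at hv
  induction hv using Submodule.span_induction with
  | mem x hx => obtain ⟨A, hA, rfl⟩ := hx; exact hz A hA
  | zero => exact h0
  | add x y _ _ hx hy => exact hadd x y hx hy
  | smul r x _ hx => exact hsmul r x hx

lemma top_mem_filtration (i : ι ⊕ β) (A : Multiset ι) :
    top R i A ∈ filtration R ι (A.card + 1) := by
  rcases i with i | s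
  · exact z_mem_filtration (by simp)
  · exact zero_mem _

/-- A linear map out of `L` is controlled by its values on the basis. -/
lemma basis_induction (b : Module.Basis (ι ⊕ β) R L) {p : L → Prop} (hb : ∀ i, p (b i)) (h0 : p 0)
    (hadd : ∀ x y, p x → p y → p (x + y)) (hsmul : ∀ (r : R) x, p x → p (r • x)) (x : L) : p x := by
  have hx := b.mem_span x
  induction hx using Submodule.span_induction with
  | mem x hx => obtain ⟨i, rfl⟩ := hx; exact hb i
  | zero => exact h0
  | add x y _ _ hx hy => exact hadd x y hx hy
  | smul r x _ hx => exact hsmul r x hx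

lemma mem_filtration_of_basis {n : ℕ} {A : Multiset ι} (b : Module.Basis (ι ⊕ β) R L)
    (ρ : L →ₗ[R] Module.End R (Mon R ι))
    (hA : A.card < n) (h : ∀ i, ρ (b i) (z R A) - top R i A ∈ filtration R ι A.card) (x : L) :
    ρ x (z R A) ∈ filtration R ι n := by
  refine filtration_mono (Nat.succ_le_of_lt hA) ?_
  induction x using basis_induction b with
  | hb i =>
    rw [← sub_add_cancel (ρ (b i) (z R A)) (top R i A)]
    exact add_mem (filtration_mono (Nat.le_succ _) (h i)) (top_mem_filtration i A)
  | h0 => simp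
  | hadd x y hx hy => rw [map_add]; exact add_mem hx hy
  | hsmul r x hx => rw [map_smul]; exact Submodule.smul_mem _ r hx

variable [LinearOrder ι]

/-- The relation `j < i`, where all elements of `β` are larger than those of `ι`. -/
def Below (j : ι) (i : ι ⊕ β) : Prop := Sum.elim (fun i => j < i) (fun _ => True) i

/-- The scalar by which a basis element acts on the vacuum, up to the leading term. -/
def scalar (b : Module.Basis (ι ⊕ β) R L) (χ : L →ₗ[R] R) (i : ι ⊕ β) : R :=
  Sum.elim (fun _ => 0) (fun s => χ (b (inr s))) i

variable (b : Module.Basis (ι ⊕ β) R L) (χ : L →ₗ[R] R)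

open Classical in
/-- The action of the basis element `i` on `z A`, given the action on shorter monomials. -/
def step (ρ : L →ₗ[R] Module.End R (Mon R ι)) (i : ι ⊕ β) (A : Multiset ι) : Mon R ι :=
  match A.sort with
  | [] => top R i A + scalar b χ i • z R A
  | j :: l => if Below j i then
      top R i A + ρ (b (inl j)) (ρ (b i) (z R (l : Multiset ι)) - top R i l)
        + ρ ⁅b i, b (inl j)⁆ (z R (l : Multiset ι))
    else top R i A

/-- The action on monomials of length less than `n`. -/
def approx : ℕ → L →ₗ[R] Module.End R (Mon R ι)
  | 0 => 0
  | n + 1 => b.constr R fun i => Finsupp.lift _ R _ (step b χ (approx n) i)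

/-- The action of the Lie algebra on the free module on the ordered monomials. -/
def act : L →ₗ[R] Module.End R (Mon R ι) :=
  b.constr R fun i => Finsupp.lift _ R _ fun A => approx b χ (A.card + 1) (b i) (z R A)

lemma multiset_min_induction {p : Multiset ι → Prop} (h0 : p 0)
    (hcons : ∀ j B, (∀ a ∈ B, j ≤ a) → p B → p (j ::ₘ B)) (A : Multiset ι) : p A := by
  suffices ∀ l : List ι, l.Pairwise (· ≤ ·) → p (l : Multiset ι) by
    have h := this A.sort (Multiset.pairwise_sort A (· ≤ ·))
    rwa [Multiset.sort_eq] at h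
  intro l hl
  induction l with
  | nil => exact h0
  | cons j l ih =>
    rw [List.pairwise_cons] at hl
    exact hcons j l (by simpa using hl.1) (ih hl.2)

lemma multiset_min_cases (A : Multiset ι) :
    A = 0 ∨ ∃ j B, (∀ a ∈ B, j ≤ a) ∧ A = j ::ₘ B :=
  multiset_min_induction (p := fun A => A = 0 ∨ ∃ j B, (∀ a ∈ B, j ≤ a) ∧ A = j ::ₘ B)
    (Or.inl rfl) (fun j B h _ => Or.inr ⟨j, B, h, rfl⟩) A

lemma step_zero (ρ : L →ₗ[R] Module.End R (Mon R ι)) (i : ι ⊕ β) :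
    step b χ ρ i 0 = top R i 0 + scalar b χ i • z R 0 := by
  simp [step]

lemma step_cons (ρ : L →ₗ[R] Module.End R (Mon R ι)) {i : ι ⊕ β} {j : ι} {B : Multiset ι}
    (hB : ∀ a ∈ B, j ≤ a) (hi : Below j i) :
    step b χ ρ i (j ::ₘ B) = top R i (j ::ₘ B) + ρ (b (inl j)) (ρ (b i) (z R B) - top R i B)
      + ρ ⁅b i, b (inl j)⁆ (z R B) := by
  rw [step, Multiset.sort_cons _ _ _ hB]
  simp [hi]

lemma step_cons_of_not (ρ : L →ₗ[R] Module.End R (Mon R ι)) {i : ι ⊕ β} {j : ι} {B : Multiset ι}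
    (hB : ∀ a ∈ B, j ≤ a) (hi : ¬ Below j i) :
    step b χ ρ i (j ::ₘ B) = top R i (j ::ₘ B) := by
  rw [step, Multiset.sort_cons _ _ _ hB]
  simp [hi]

lemma approx_succ (n : ℕ) (i : ι ⊕ β) (A : Multiset ι) :
    approx b χ (n + 1) (b i) (z R A) = step b χ (approx b χ n) i A := by
  simp [approx]

lemma act_z (i : ι ⊕ β) (A : Multiset ι) :
    act b χ (b i) (z R A) = approx b χ (A.card + 1) (b i) (z R A) := by
  simp [act]

lemma approx_sub_top_mem (n : ℕ) (A : Multiset ι) (hA : A.card < n) (i : ι ⊕ β) :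
    approx b χ n (b i) (z R A) - top R i A ∈ filtration R ι A.card := by
  induction n generalizing A i with
  | zero => simp at hA
  | succ n ih =>
    rw [approx_succ]
    rcases multiset_min_cases A with rfl | ⟨j, B, hB, rfl⟩
    · rw [step_zero, add_sub_cancel_left]
      exact Submodule.smul_mem _ _ (z_mem_filtration le_rfl)
    have hBn : B.card < n := by simpa using hA
    have hx : ∀ (C : Multiset ι), C.card ≤ B.card → ∀ x,
        approx b χ n x (z R C) ∈ filtration R ι (j ::ₘ B).card := fun C hC x =>
      mem_filtration_of_basis b _ (by simpa [Nat.lt_succ_iff] using hC)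
        (fun i => ih C (by omega) i) x
    by_cases hi : Below j i
    · rw [step_cons b χ _ hB hi, add_assoc, add_sub_cancel_left]
      refine add_mem ?_ (hx B le_rfl _)
      refine filtration_induction (p := fun v => approx b χ n (b (inl j)) v ∈ _)
        (fun C hC => hx C hC _) (by simp) (fun v w hv hw => ?_) (fun r v hv => ?_)
        (ih B hBn i)
      · rw [map_add]; exact add_mem hv hw
      · rw [map_smul]; exact Submodule.smul_mem _ r hv
    · rw [step_cons_of_not b χ _ hB hi, sub_self]
      exact zero_mem _

lemma approx_stable_aux (n : ℕ) (A : Multiset ι) (hA : A.card < n) (x : L) :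
    approx b χ (n + 1) x (z R A) = approx b χ n x (z R A) := by
  induction n generalizing A x with
  | zero => simp at hA
  | succ n ih =>
    induction x using basis_induction b with
    | h0 => simp
    | hadd x y hx hy => simp only [map_add, LinearMap.add_apply, hx, hy]
    | hsmul r x hx => simp only [map_smul, LinearMap.smul_apply, hx]
    | hb i =>
      rw [approx_succ, approx_succ]
      rcases multiset_min_cases A with rfl | ⟨j, B, hB, rfl⟩
      · rw [step_zero, step_zero]
      have hBn : B.card < n := by simpa using hA
      by_cases hi : Below j i
      · rw [step_cons b χ _ hB hi, step_cons b χ _ hB hi, ih B hBn, ih B hBn]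
        congr 2
        refine filtration_induction
          (p := fun v => approx b χ (n + 1) (b (inl j)) v = approx b χ n (b (inl j)) v)
          (fun C hC => ih C (by omega) _) (by simp) (fun v w hv hw => ?_) (fun r v hv => ?_)
          (approx_sub_top_mem b χ n B hBn i)
        · rw [map_add, map_add, hv, hw]
        · rw [map_smul, map_smul, hv]
      · rw [step_cons_of_not b χ _ hB hi, step_cons_of_not b χ _ hB hi]

lemma approx_eq_act {n : ℕ} {A : Multiset ι} (hA : A.card < n) (x : L) :
    approx b χ n x (z R A) = act b χ x (z R A) := by
  induction x using basis_induction b with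
  | h0 => simp
  | hadd x y hx hy => simp only [map_add, LinearMap.add_apply, hx, hy]
  | hsmul r x hx => simp only [map_smul, LinearMap.smul_apply, hx]
  | hb i =>
    rw [act_z]
    induction n, Nat.succ_le_of_lt hA using Nat.le_induction with
    | base => rfl
    | succ n hn ih => rw [approx_stable_aux b χ n A hn, ih hn]

lemma approx_eq_act_of_mem {m n : ℕ} (hm : m < n) {v : Mon R ι} (hv : v ∈ filtration R ι m)
    (x : L) : approx b χ n x v = act b χ x v := by
  refine filtration_induction (p := fun v => approx b χ n x v = act b χ x v)
    (fun C hC => approx_eq_act b χ (by omega) _) (by simp) (fun v w hv hw => ?_)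
    (fun r v hv => ?_) hv
  · rw [map_add, map_add, hv, hw]
  · rw [map_smul, map_smul, hv]

lemma act_sub_top_mem (A : Multiset ι) (i : ι ⊕ β) :
    act b χ (b i) (z R A) - top R i A ∈ filtration R ι A.card := by
  rw [act_z]
  exact approx_sub_top_mem b χ _ A (Nat.lt_succ_self _) i

lemma act_z_zero (i : ι ⊕ β) :
    act b χ (b i) (z R 0) = top R i 0 + scalar b χ i • z R 0 := by
  rw [act_z, approx_succ, step_zero]

lemma act_z_zero_inr (s : β) : act b χ (b (inr s)) (z R 0) = χ (b (inr s)) • z R 0 := by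
  simp [act_z_zero, top, scalar]

lemma act_z_of_le {i : ι} {A : Multiset ι} (h : ∀ a ∈ A, i ≤ a) :
    act b χ (b (inl i)) (z R A) = z R (i ::ₘ A) := by
  rw [act_z, approx_succ]
  rcases multiset_min_cases A with rfl | ⟨j, B, hB, rfl⟩
  · simp [step_zero, top, scalar]
  · rw [step_cons_of_not b χ _ hB]
    · rfl
    · simpa [Below] using h j (by simp)

lemma act_top {i : ι ⊕ β} {j : ι} {B : Multiset ι} (hB : ∀ a ∈ B, j ≤ a) (hi : Below j i) :
    act b χ (b (inl j)) (top R i B) = top R i (j ::ₘ B) := by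
  rcases i with i | s
  · have hi : j < i := hi
    rw [top, elim_inl, act_z_of_le]
    · rw [Multiset.cons_swap]; rfl
    · intro a ha
      rcases Multiset.mem_cons.mp ha with rfl | ha
      · exact hi.le
      · exact hB a ha
  · simp [top]

lemma act_z_cons {i : ι ⊕ β} {j : ι} {B : Multiset ι} (hB : ∀ a ∈ B, j ≤ a) (hi : Below j i) :
    act b χ (b i) (z R (j ::ₘ B)) =
      act b χ (b (inl j)) (act b χ (b i) (z R B)) + act b χ ⁅b i, b (inl j)⁆ (z R B) := by
  have hc : B.card < (j ::ₘ B).card := by simp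
  rw [act_z, approx_succ, step_cons b χ _ hB hi, approx_eq_act b χ hc, approx_eq_act b χ hc,
    approx_eq_act_of_mem b χ hc (act_sub_top_mem b χ B i), map_sub, act_top b χ hB hi]
  abel

/-- The commutation relation of `x` and `y` on the vector `v`. -/
def Commutes (x y : L) (v : Mon R ι) : Prop :=
  act b χ x (act b χ y v) = act b χ y (act b χ x v) + act b χ ⁅x, y⁆ v

variable {b χ}

lemma Commutes.symm {x y : L} {v : Mon R ι} (h : Commutes b χ x y v) : Commutes b χ y x v := by
  rw [Commutes, ← lie_skew y x, map_neg, LinearMap.neg_apply, h]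
  abel

lemma Commutes.of_basis {v : Mon R ι} (h : ∀ i j, Commutes b χ (b i) (b j) v) (x y : L) :
    Commutes b χ x y v := by
  induction x using basis_induction b with
  | h0 => simp [Commutes]
  | hadd x x' hx hx' =>
    simp only [Commutes, map_add, add_lie, LinearMap.add_apply] at *
    rw [hx, hx']; abel
  | hsmul r x hx =>
    simp only [Commutes, map_smul, smul_lie, LinearMap.smul_apply] at *
    rw [hx, smul_add]
  | hb i =>
    induction y using basis_induction b with
    | h0 => simp [Commutes]
    | hadd x x' hx hx' =>
      simp only [Commutes, map_add, lie_add, LinearMap.add_apply] at *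
      rw [hx, hx']; abel
    | hsmul r x hx =>
      simp only [Commutes, map_smul, lie_smul, LinearMap.smul_apply] at *
      rw [hx, smul_add]
    | hb j => exact h i j

lemma Commutes.of_mem {n : ℕ} {x y : L}
    (h : ∀ A : Multiset ι, A.card ≤ n → Commutes b χ x y (z R A)) {v : Mon R ι}
    (hv : v ∈ filtration R ι n) : Commutes b χ x y v := by
  refine filtration_induction h (by simp [Commutes]) (fun v w hv hw => ?_) (fun r v hv => ?_) hv
  · simp only [Commutes, map_add] at *
    rw [hv, hw]; abel
  · simp only [Commutes, map_smul] at *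
    rw [hv, smul_add]

lemma Commutes.add {x y : L} {v w : Mon R ι} (hv : Commutes b χ x y v)
    (hw : Commutes b χ x y w) : Commutes b χ x y (v + w) := by
  simp only [Commutes, map_add] at *
  rw [hv, hw]; abel

lemma commutes_of_le {i : ι ⊕ β} {j : ι} {A : Multiset ι} (hA : ∀ a ∈ A, j ≤ a)
    (hi : Below j i) : Commutes b χ (b i) (b (inl j)) (z R A) := by
  rw [Commutes, act_z_of_le b χ hA, act_z_cons b χ hA hi]

lemma act_act_z_cons {i j : ι ⊕ β} {k : ι} {B : Multiset ι} (hB : ∀ a ∈ B, k ≤ a)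
    (hi : Below k i) (hj : Below k j)
    (ih : ∀ C : Multiset ι, C.card ≤ B.card → ∀ x y, Commutes b χ x y (z R C)) :
    act b χ (b i) (act b χ (b j) (z R (k ::ₘ B))) =
      act b χ (b (inl k)) (act b χ (b i) (act b χ (b j) (z R B))) +
        act b χ ⁅b i, b (inl k)⁆ (act b χ (b j) (z R B)) +
        act b χ ⁅b j, b (inl k)⁆ (act b χ (b i) (z R B)) +
        act b χ ⁅b i, ⁅b j, b (inl k)⁆⁆ (z R B) := by
  have h1 : Commutes b χ (b i) (b (inl k)) (act b χ (b j) (z R B)) := by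
    rw [← sub_add_cancel (act b χ (b j) (z R B)) (top R j B)]
    refine Commutes.add (Commutes.of_mem (fun C hC => ih C hC _ _) (act_sub_top_mem b χ B j)) ?_
    rcases j with j | s
    · have hj : k < j := hj
      refine commutes_of_le (fun a ha => ?_) hi
      rcases Multiset.mem_cons.mp ha with rfl | ha
      · exact hj.le
      · exact hB a ha
    · simp [top, Commutes]
  rw [act_z_cons b χ hB hj, map_add, h1, ih B le_rfl (b i) ⁅b j, b (inl k)⁆]
  abel

lemma commutes_cons {i j : ι ⊕ β} {k : ι} {B : Multiset ι} (hB : ∀ a ∈ B, k ≤ a)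
    (hi : Below k i) (hj : Below k j)
    (ih : ∀ C : Multiset ι, C.card ≤ B.card → ∀ x y, Commutes b χ x y (z R C)) :
    Commutes b χ (b i) (b j) (z R (k ::ₘ B)) := by
  have h1 : act b χ ⁅b i, b j⁆ (z R (k ::ₘ B)) =
      act b χ (b (inl k)) (act b χ ⁅b i, b j⁆ (z R B)) +
        act b χ ⁅⁅b i, b j⁆, b (inl k)⁆ (z R B) := by
    rw [← act_z_of_le b χ hB]
    exact ih B le_rfl _ _
  rw [Commutes, act_act_z_cons hB hi hj ih, act_act_z_cons hB hj hi ih, h1,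
    ih B le_rfl (b i) (b j), lie_lie (b i) (b j), map_add, map_sub, LinearMap.sub_apply]
  abel

lemma act_z_zero_of_mem {x : L} (hx : x ∈ Submodule.span R (Set.range fun s => b (inr s))) :
    act b χ x (z R 0) = χ x • z R 0 := by
  induction hx using Submodule.span_induction with
  | mem x hx => obtain ⟨s, rfl⟩ := hx; exact act_z_zero_inr b χ s
  | zero => simp
  | add x y _ _ hx hy => rw [map_add, LinearMap.add_apply, hx, hy, map_add, add_smul]
  | smul r x _ hx => rw [map_smul, LinearMap.smul_apply, hx, map_smul, smul_eq_mul, mul_smul]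

/-- The elements `b (inr s)` span a Lie subalgebra on which `χ` is a character. -/
def IsCharacter (b : Module.Basis (ι ⊕ β) R L) (χ : L →ₗ[R] R) : Prop :=
  ∀ s t, ⁅b (inr s), b (inr t)⁆ ∈ Submodule.span R (Set.range fun s => b (inr s)) ∧
    χ ⁅b (inr s), b (inr t)⁆ = 0

lemma below_of_not {i : ι ⊕ β} {k : ι} {B : Multiset ι} (hB : ∀ a ∈ B, k ≤ a)
    (h : ∀ i', i = inl i' → ¬ ∀ a ∈ k ::ₘ B, i' ≤ a) : Below k i := by
  rcases i with i | s
  · by_contra hk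
    have hik : i ≤ k := not_lt.mp hk
    refine h i rfl fun a ha => ?_
    rcases Multiset.mem_cons.mp ha with rfl | ha
    · exact hik
    · exact hik.trans (hB a ha)
  · trivial

lemma commutes_of_forall_le {j : ι} {A : Multiset ι} (hA : ∀ a ∈ A, j ≤ a) (i : ι ⊕ β) :
    Commutes b χ (b i) (b (inl j)) (z R A) := by
  by_cases hi : Below j i
  · exact commutes_of_le hA hi
  · rcases i with i | s
    · have hij : i ≤ j := not_lt.mp hi
      rcases hij.eq_or_lt with rfl | hij
      · simp [Commutes]
      · exact (commutes_of_le (i := inl j) (fun a ha => hij.le.trans (hA a ha)) hij).symm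
    · exact absurd trivial hi

lemma commutes_z (hχ : IsCharacter b χ) (A : Multiset ι) (x y : L) :
    Commutes b χ x y (z R A) := by
  suffices ∀ n (A : Multiset ι), A.card < n → ∀ x y, Commutes b χ x y (z R A) from
    this _ A (Nat.lt_succ_self _) x y
  intro n
  induction n with
  | zero => simp
  | succ n ih =>
    intro A hA
    refine Commutes.of_basis fun i j => ?_
    by_cases hi : ∃ i', i = inl i' ∧ ∀ a ∈ A, i' ≤ a
    · obtain ⟨i', rfl, hi⟩ := hi
      exact (commutes_of_forall_le hi j).symm
    by_cases hj : ∃ j', j = inl j' ∧ ∀ a ∈ A, j' ≤ a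
    · obtain ⟨j', rfl, hj⟩ := hj
      exact commutes_of_forall_le hj i
    push Not at hi hj
    rcases multiset_min_cases A with rfl | ⟨k, B, hB, rfl⟩
    · rcases i with i | s
      · simpa using hi i rfl
      rcases j with j | t
      · simpa using hj j rfl
      rw [Commutes, act_z_zero_of_mem (hχ s t).1, (hχ s t).2, act_z_zero_inr, act_z_zero_inr,
        map_smul, map_smul, act_z_zero_inr, act_z_zero_inr, smul_comm]
      simp
    · refine commutes_cons hB (below_of_not hB fun i' h h' => ?_)
        (below_of_not hB fun i' h h' => ?_) fun C hC => ih C (by simp at hA; omega)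
      · obtain ⟨a, ha, hlt⟩ := hi i' h; exact absurd (h' a ha) (not_le.mpr hlt)
      · obtain ⟨a, ha, hlt⟩ := hj i' h; exact absurd (h' a ha) (not_le.mpr hlt)

section

attribute [local instance 100] LieRing.ofAssociativeRing

/-- The action on the free module on the ordered monomials, as a Lie algebra morphism. -/
def rep (hχ : IsCharacter b χ) : L →ₗ⁅R⁆ Module.End R (Mon R ι) :=
  { act b χ with
    map_lie' := fun {x y} => by
      refine Finsupp.lhom_ext' fun A => LinearMap.ext_ring ?_
      have := commutes_z hχ A x y
      simp only [Commutes] at this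
      simp [LieRing.of_associative_ring_bracket, this] }

/-- The action of the universal enveloping algebra. -/
def envRep (hχ : IsCharacter b χ) :
    UniversalEnvelopingAlgebra R L →ₐ[R] Module.End R (Mon R ι) :=
  UniversalEnvelopingAlgebra.lift R (rep hχ)

lemma envRep_ι (hχ : IsCharacter b χ) (x : L) :
    envRep hχ (UniversalEnvelopingAlgebra.ι R x) = act b χ x :=
  UniversalEnvelopingAlgebra.lift_ι_apply R (rep hχ) x

lemma env_induction {p : UniversalEnvelopingAlgebra R L → Prop}
    (halg : ∀ r, p (algebraMap R _ r)) (hι : ∀ x, p (UniversalEnvelopingAlgebra.ι R x))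
    (hadd : ∀ a a', p a → p a' → p (a + a')) (hmul : ∀ a a', p a → p a' → p (a * a'))
    (a : UniversalEnvelopingAlgebra R L) : p a := by
  set S := Algebra.adjoin R (Set.range (UniversalEnvelopingAlgebra.ι R (L := L))) with hS
  let g : L →ₗ⁅R⁆ S :=
    { toFun := fun x => ⟨UniversalEnvelopingAlgebra.ι R x, Algebra.subset_adjoin ⟨x, rfl⟩⟩
      map_add' := fun x y => Subtype.ext (map_add _ x y)
      map_smul' := fun c x => Subtype.ext (map_smul _ c x)
      map_lie' := fun {x y} => Subtype.ext (LieHom.map_lie _ x y) }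
  have hid : S.val.comp (UniversalEnvelopingAlgebra.lift R g) = AlgHom.id R _ := by
    refine UniversalEnvelopingAlgebra.hom_ext R (LieHom.ext fun x => ?_)
    change ((UniversalEnvelopingAlgebra.lift R g (UniversalEnvelopingAlgebra.ι R x) : S) :
      UniversalEnvelopingAlgebra R L) = _
    rw [UniversalEnvelopingAlgebra.lift_ι_apply]
    rfl
  have ha : a ∈ S := by
    have := DFunLike.congr_fun hid a
    change ((UniversalEnvelopingAlgebra.lift R g a : S) : UniversalEnvelopingAlgebra R L) = a at this
    rw [← this]
    exact Subtype.property _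
  induction ha using Algebra.adjoin_induction with
  | mem x hx => obtain ⟨x, rfl⟩ := hx; exact hι x
  | algebraMap r => exact halg r
  | add a a' _ _ h h' => exact hadd a a' h h'
  | mul a a' _ _ h h' => exact hmul a a' h h'

lemma ι_mul_ι (x y : L) :
    UniversalEnvelopingAlgebra.ι R x * UniversalEnvelopingAlgebra.ι R y =
      UniversalEnvelopingAlgebra.ι R y * UniversalEnvelopingAlgebra.ι R x +
        UniversalEnvelopingAlgebra.ι R ⁅x, y⁆ := by
  rw [LieHom.map_lie, LieRing.of_associative_ring_bracket]
  abel

end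

variable {V : Type*} [AddCommGroup V] [Module R V] [Module (UniversalEnvelopingAlgebra R L) V]

variable (b) in
/-- The product of the basis elements `b (inl i)` for `i` in a list. -/
def word (l : List ι) : UniversalEnvelopingAlgebra R L :=
  (l.map fun i => UniversalEnvelopingAlgebra.ι R (b (inl i))).prod

variable (b) in
/-- The linear map which sends the ordered monomials to the ordered monomials applied to `v`. -/
def realize (v : V) : Mon R ι →ₗ[R] V := Finsupp.lift _ R _ fun A => word b A.sort • v

lemma realize_z (v : V) (A : Multiset ι) : realize b v (z R A) = word b A.sort • v := by
  simp [realize]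

lemma realize_cons (v : V) {j : ι} {B : Multiset ι} (hB : ∀ a ∈ B, j ≤ a) :
    realize b v (z R (j ::ₘ B)) =
      UniversalEnvelopingAlgebra.ι R (b (inl j)) • realize b v (z R B) := by
  rw [realize_z, realize_z, Multiset.sort_cons _ _ _ hB, word, List.map_cons, List.prod_cons,
    mul_smul, word]

lemma realize_top (v : V) (i : ι ⊕ β) {k : ι} {B : Multiset ι} (hB : ∀ a ∈ B, k ≤ a)
    (hi : Below k i) :
    realize b v (top R i (k ::ₘ B)) =
      UniversalEnvelopingAlgebra.ι R (b (inl k)) • realize b v (top R i B) := by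
  rcases i with i | s
  · have hi : k < i := hi
    rw [top, elim_inl, Multiset.cons_swap, realize_cons]
    · rfl
    · intro a ha
      rcases Multiset.mem_cons.mp ha with rfl | ha
      · exact hi.le
      · exact hB a ha
  · simp [top]

variable [IsScalarTower R (UniversalEnvelopingAlgebra R L) V]

lemma realize_act_z {v : V} (hv : ∀ s, UniversalEnvelopingAlgebra.ι R (b (inr s)) • v =
    χ (b (inr s)) • v) (n : ℕ) (A : Multiset ι) (hA : A.card < n) (x : L) :
    realize b v (act b χ x (z R A)) =
      UniversalEnvelopingAlgebra.ι R x • realize b v (z R A) := by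
  induction n generalizing A x with
  | zero => simp at hA
  | succ n ih =>
    induction x using basis_induction b with
    | h0 => simp
    | hadd x y hx hy => simp only [map_add, LinearMap.add_apply, hx, hy, add_smul]
    | hsmul r x hx => simp only [map_smul, LinearMap.smul_apply, hx, smul_assoc]
    | hb i =>
      by_cases hi : ∃ i', i = inl i' ∧ ∀ a ∈ A, i' ≤ a
      · obtain ⟨i', rfl, hi⟩ := hi
        rw [act_z_of_le b χ hi, realize_cons v hi]
      push Not at hi
      rcases multiset_min_cases A with rfl | ⟨k, B, hB, rfl⟩
      · rcases i with i | s
        · simpa using hi i rfl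
        · rw [act_z_zero_inr, map_smul, realize_z, Multiset.sort_zero, word, List.map_nil,
            List.prod_nil, one_smul, hv]
      · have hik : Below k i := below_of_not hB fun i' h h' => by
          obtain ⟨a, ha, hlt⟩ := hi i' h; exact absurd (h' a ha) (not_le.mpr hlt)
        have hBn : B.card < n := by simpa using hA
        have h1 : realize b v (act b χ (b (inl k)) (act b χ (b i) (z R B) - top R i B)) =
            UniversalEnvelopingAlgebra.ι R (b (inl k)) •
              realize b v (act b χ (b i) (z R B) - top R i B) := by
          refine filtration_induction (p := fun m => realize b v (act b χ (b (inl k)) m) =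
            UniversalEnvelopingAlgebra.ι R (b (inl k)) • realize b v m)
            (fun C hC => ih C (by omega) _) (by simp) (fun v w hv hw => ?_) (fun r v hv => ?_)
            (act_sub_top_mem b χ B i)
          · simp only [map_add, smul_add, hv, hw]
          · simp only [map_smul, hv, smul_algebra_smul_comm]
        rw [map_sub, map_sub, map_sub, smul_sub, act_top b χ hB hik, realize_top v i hB hik,
          sub_left_inj] at h1
        rw [act_z_cons b χ hB hik, map_add, h1, ih B hBn, ih B hBn, realize_cons v hB, ← mul_smul,
          ← mul_smul, ι_mul_ι (b i), add_smul]

lemma realize_act {v : V} (hv : ∀ s, UniversalEnvelopingAlgebra.ι R (b (inr s)) • v =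
    χ (b (inr s)) • v) (x : L) (m : Mon R ι) :
    realize b v (act b χ x m) = UniversalEnvelopingAlgebra.ι R x • realize b v m := by
  induction m using Finsupp.induction_linear with
  | zero => simp
  | add m m' h h' => simp only [map_add, smul_add, h, h']
  | single A r =>
    rw [← mul_one r, ← smul_eq_mul, ← Finsupp.smul_single]
    simp only [map_smul, smul_algebra_smul_comm, realize_act_z hv _ A (Nat.lt_succ_self _)]

lemma realize_envRep (hχ : IsCharacter b χ) {v : V}
    (hv : ∀ s, UniversalEnvelopingAlgebra.ι R (b (inr s)) • v = χ (b (inr s)) • v)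
    (a : UniversalEnvelopingAlgebra R L) (m : Mon R ι) :
    realize b v (envRep hχ a m) = a • realize b v m := by
  induction a using env_induction generalizing m with
  | halg r => simp [Module.algebraMap_end_apply, algebraMap_smul]
  | hι x => rw [envRep_ι, realize_act hv]
  | hadd a a' h h' => rw [map_add, LinearMap.add_apply, map_add, h, h', add_smul]
  | hmul a a' h h' => rw [map_mul, Module.End.mul_apply, h, h', mul_smul]

lemma act_word (l : List ι) (hl : l.Pairwise (· ≤ ·)) (hχ : IsCharacter b χ) :
    envRep hχ (word b l) (z R 0) = z R (l : Multiset ι) := by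
  induction l with
  | nil => simp [word]
  | cons j l ih =>
    rw [List.pairwise_cons] at hl
    rw [word, List.map_cons, List.prod_cons, map_mul, Module.End.mul_apply, ← word, ih hl.2,
      envRep_ι, act_z_of_le]
    · rfl
    · simpa using hl.1

/-- **Poincaré–Birkhoff–Witt theorem for induced modules.** The ordered monomials in the elements
`b (inl i)`, applied to the generator, form a basis of a module which is induced from the
character `χ` of the subalgebra spanned by the elements `b (inr s)`. -/
def basis (hχ : IsCharacter b χ) (v : V)
    (hv : ∀ s, UniversalEnvelopingAlgebra.ι R (b (inr s)) • v = χ (b (inr s)) • v)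
    (hgen : ∀ w : V, ∃ a : UniversalEnvelopingAlgebra R L, a • v = w) (Φ : V →ₗ[R] Mon R ι)
    (hΦ : ∀ a : UniversalEnvelopingAlgebra R L, Φ (a • v) = envRep hχ a (z R 0)) :
    Module.Basis (Multiset ι) R V :=
  .ofRepr <| LinearEquiv.ofLinearMap Φ (realize b v)
    (by
      refine Finsupp.lhom_ext' fun A => LinearMap.ext_ring ?_
      change Φ (realize b v (z R A)) = z R A
      rw [realize_z, hΦ, act_word _ (Multiset.pairwise_sort A (· ≤ ·)), Multiset.sort_eq])
    (by
      refine LinearMap.ext fun w => ?_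
      obtain ⟨a, rfl⟩ := hgen w
      change realize b v (Φ (a • v)) = a • v
      rw [hΦ, realize_envRep hχ hv, realize_z, Multiset.sort_zero, word, List.map_nil,
        List.prod_nil, one_smul])

lemma basis_apply (hχ : IsCharacter b χ) (v : V)
    (hv : ∀ s, UniversalEnvelopingAlgebra.ι R (b (inr s)) • v = χ (b (inr s)) • v)
    (hgen : ∀ w : V, ∃ a : UniversalEnvelopingAlgebra R L, a • v = w) (Φ : V →ₗ[R] Mon R ι)
    (hΦ : ∀ a : UniversalEnvelopingAlgebra R L, Φ (a • v) = envRep hχ a (z R 0))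
    (A : Multiset ι) : basis hχ v hv hgen Φ hΦ A = word b A.sort • v :=
  realize_z v A

end InducedModule

end

noncomputable section

namespace FormalCharacter

variable {V I W : Type*} [AddCommGroup V] [Module ℂ V] (b : Module.Basis I ℂ V)

/-- The span of the basis vectors with index in `s`. -/
def coordSubmodule (s : Set I) : Submodule ℂ V :=
  (Finsupp.supported ℂ ℂ s).comap (b.repr : V →ₗ[ℂ] I →₀ ℂ)

lemma mem_coordSubmodule {s : Set I} {v : V} :
    v ∈ coordSubmodule b s ↔ ∀ i, b.repr v i ≠ 0 → i ∈ s := by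
  simp [coordSubmodule, Finsupp.mem_supported, Set.subset_def]

/-- The coordinates on `coordSubmodule`. -/
def coordEquiv (s : Set I) : coordSubmodule b s ≃ₗ[ℂ] (s →₀ ℂ) :=
  (b.repr.ofSubmodule' _).trans (Finsupp.supportedEquivFinsupp s)

lemma finrank_coordSubmodule (s : Set I) :
    Module.finrank ℂ (coordSubmodule b s) = s.ncard := by
  rw [(coordEquiv b s).finrank_eq]
  by_cases hs : s.Finite
  · have := hs.fintype
    rw [Module.finrank_finsupp_self, ← Nat.card_eq_fintype_card, Nat.card_coe_set_eq]
  · rw [Set.Infinite.ncard hs]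
    refine Module.finrank_of_not_finite fun h => hs ?_
    exact Set.finite_coe_iff.mp (Module.Finite.finite_basis (Finsupp.basisSingleOne (R := ℂ)))

lemma finiteDimensional_coordSubmodule {s : Set I} (hs : s.Finite) :
    FiniteDimensional ℂ (coordSubmodule b s) := by
  have := hs.fintype
  exact Module.Finite.equiv (coordEquiv b s).symm

lemma isInternal_coordSubmodule [DecidableEq W] (w : I → W) :
    DirectSum.IsInternal fun p => coordSubmodule b {i | w i = p} := by
  rw [DirectSum.isInternal_submodule_iff_iSupIndep_and_iSup_eq_top]
  constructor
  · intro p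
    have hle : ⨆ q, ⨆ (_ : q ≠ p), coordSubmodule b {i | w i = q} ≤
        coordSubmodule b {i | w i ≠ p} :=
      iSup₂_le fun q hq => Submodule.comap_mono
        (Finsupp.supported_mono fun i (hi : w i = q) => (hi.trans_ne hq : w i ≠ p))
    refine Disjoint.mono_right hle ?_
    rw [Submodule.disjoint_def]
    intro v hv hv'
    rw [mem_coordSubmodule] at hv hv'
    refine b.repr.map_eq_zero_iff.mp (Finsupp.ext fun i => ?_)
    by_contra hi
    exact hv' i hi (hv i hi)
  · rw [eq_top_iff, ← b.span_eq, Submodule.span_le]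
    rintro _ ⟨i, rfl⟩
    refine Submodule.mem_iSup_of_mem (w i) ?_
    rw [mem_coordSubmodule]
    intro j hj
    rw [b.repr_self, Finsupp.single_apply_ne_zero] at hj
    exact hj.1 ▸ rfl

variable {b} {H L : Module.End ℂ V} {f n : I → ℂ}

lemma repr_apply (hL : ∀ i, L (b i) = n i • b i) (v : V) (i : I) :
    b.repr (L v) i = n i * b.repr v i := by
  suffices (Finsupp.lapply i).comp (b.repr.toLinearMap.comp L) =
      n i • (Finsupp.lapply i).comp b.repr.toLinearMap from DFunLike.congr_fun this v
  refine b.ext fun j => ?_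
  by_cases hij : j = i
  · subst hij; simp [hL]
  · simp [hL, hij]

lemma eigenspace_eq (hL : ∀ i, L (b i) = n i • b i) (m : ℂ) :
    Module.End.eigenspace L m = coordSubmodule b {i | n i = m} := by
  ext v
  rw [Module.End.mem_eigenspace_iff, mem_coordSubmodule, ← b.repr.injective.eq_iff,
    Finsupp.ext_iff]
  refine forall_congr' fun i => ?_
  rw [repr_apply hL, map_smul, Finsupp.smul_apply, smul_eq_mul, mul_eq_mul_right_iff]
  tauto

lemma weightSpace_eq (hH : ∀ i, H (b i) = f i • b i) (hL : ∀ i, L (b i) = n i • b i) (p : ℂ × ℂ) :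
    weightSpace H L p = coordSubmodule b {i | (f i, n i) = p} := by
  ext v
  rw [weightSpace, Submodule.mem_inf, eigenspace_eq hH, eigenspace_eq hL]
  simp only [mem_coordSubmodule, Set.mem_ofPred_eq, Prod.ext_iff, imp_and, forall_and]

lemma bounded_of_diagonal (hL : ∀ i, L (b i) = n i • b i) {B : ℝ} (hB : ∀ i, B ≤ (n i).re) (m : ℂ)
    (hm : Module.End.HasEigenvalue L m) : B ≤ m.re := by
  obtain ⟨v, hv⟩ := hm.exists_hasEigenvector
  have hmem : v ∈ Module.End.eigenspace L m := hv.1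
  rw [eigenspace_eq hL, mem_coordSubmodule] at hmem
  obtain ⟨i, hi⟩ : ∃ i, b.repr v i ≠ 0 := by
    by_contra! h
    exact hv.2 (b.repr.map_eq_zero_iff.mp (Finsupp.ext h))
  rw [← hmem i hi]
  exact hB i

lemma hasChar_of_diagonal (hL : ∀ i, L (b i) = n i • b i) (hfin : ∀ m, {i | n i = m}.Finite)
    {B : ℝ} (hB : ∀ i, B ≤ (n i).re) : HasChar L where
  isInternal := by
    rw [funext (eigenspace_eq hL)]
    exact isInternal_coordSubmodule b n
  finite m := by
    rw [eigenspace_eq hL]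
    exact finiteDimensional_coordSubmodule b (hfin m)
  bounded := ⟨B, bounded_of_diagonal hL hB⟩

lemma hasJacobiChar_of_diagonal (hH : ∀ i, H (b i) = f i • b i) (hL : ∀ i, L (b i) = n i • b i)
    (hfin : ∀ p, {i | (f i, n i) = p}.Finite) {B : ℝ} (hB : ∀ i, B ≤ (n i).re) :
    HasJacobiChar H L where
  commute := b.ext fun i => by simp [hH, hL, smul_comm (f i)]
  isInternal := by
    rw [funext (weightSpace_eq hH hL)]
    exact isInternal_coordSubmodule b fun i => (f i, n i)
  finite p := by
    rw [weightSpace_eq hH hL]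
    exact finiteDimensional_coordSubmodule b (hfin p)
  bounded := ⟨B, bounded_of_diagonal hL hB⟩

lemma char_of_diagonal (hL : ∀ i, L (b i) = n i • b i) (m : ℂ) :
    char L m = {i | n i = m}.ncard := by
  rw [char, eigenspace_eq hL, finrank_coordSubmodule]

lemma jacobiChar_of_diagonal (hH : ∀ i, H (b i) = f i • b i) (hL : ∀ i, L (b i) = n i • b i)
    (p : ℂ × ℂ) : jacobiChar H L p = {i | (f i, n i) = p}.ncard := by
  rw [jacobiChar, weightSpace_eq hH hL, finrank_coordSubmodule]

/-- The fibre sizes of a map `w`. -/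
def fiberCount (w : I → ℂ × ℂ) (p : ℂ × ℂ) : ℕ := {i | w i = p}.ncard

lemma subst_support_subset (w : I → ℂ × ℂ) (a c m : ℂ) :
    {p : ℂ × ℂ | a * p.1 + c * p.2 = m ∧ fiberCount w p ≠ 0} ⊆
      w '' {i | a * (w i).1 + c * (w i).2 = m} := by
  rintro p ⟨hp, hne⟩
  obtain ⟨i, rfl⟩ := Set.nonempty_of_ncard_ne_zero hne
  exact ⟨i, hp, rfl⟩

lemma canSubst_fiberCount (w : I → ℂ × ℂ) (a c : ℂ)
    (hfin : ∀ m, {i | a * (w i).1 + c * (w i).2 = m}.Finite) :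
    CanSubst (fiberCount w) a c :=
  fun m => ((hfin m).image w).subset (subst_support_subset w a c m)

lemma subst_fiberCount (w : I → ℂ × ℂ) (a c m : ℂ)
    (hfin : {i | a * (w i).1 + c * (w i).2 = m}.Finite) :
    subst (fiberCount w) a c m = {i | a * (w i).1 + c * (w i).2 = m}.ncard := by
  classical
  set S := hfin.toFinset with hS
  have hmem : ∀ i, i ∈ S ↔ a * (w i).1 + c * (w i).2 = m := fun i => by simp [hS]
  rw [Set.ncard_eq_toFinset_card _ hfin, ← hS, Finset.card_eq_sum_card_image w, subst,
    ← finsum_mem_coe_finset]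
  have hcard : ∀ p ∈ {p : ℂ × ℂ | a * p.1 + c * p.2 = m},
      fiberCount w p = (S.filter fun i => w i = p).card := by
    intro p hp
    rw [fiberCount, ← Set.ncard_coe_finset]
    congr 1
    ext i
    simp only [Finset.coe_filter, Set.mem_ofPred_eq, hmem]
    constructor
    · rintro rfl; exact ⟨hp, rfl⟩
    · exact And.right
  rw [finsum_mem_congr rfl hcard]
  refine finsum_mem_inter_support_eq' _ _ _ fun p hp => ?_
  have hne : (S.filter fun i => w i = p).Nonempty := Finset.card_ne_zero.mp hp
  obtain ⟨i, hi⟩ := hne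
  obtain ⟨hiS, rfl⟩ := Finset.mem_filter.mp hi
  simp only [Set.mem_ofPred_eq, Finset.mem_coe]
  exact ⟨fun _ => Finset.mem_image_of_mem w hiS, fun _ => (hmem i).mp hiS⟩

end FormalCharacter

end

noncomputable section

open Sum InducedModule

namespace InducedModule

lemma weight_prod_smul {R U V ι : Type*} [CommRing R] [Ring U] [AddCommGroup V] [Module R V]
    [Module U V] [SMulCommClass U R V] [LinearOrder ι] {D : Module.End R V} {v : V} {x : ι → U}
    {wt : ι → R} (hv : D v = 0)
    (hx : ∀ i w, D (x i • w) = x i • D w + wt i • x i • w) (A : Multiset ι) :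
    D ((A.sort.map x).prod • v) = (A.map wt).sum • (A.sort.map x).prod • v := by
  suffices ∀ l : List ι, D ((l.map x).prod • v) = (l.map wt).sum • (l.map x).prod • v by
    conv_rhs => enter [1, 1, 2]; rw [← A.sort_eq (· ≤ ·)]
    exact this _
  intro l
  induction l with
  | nil => simp [hv]
  | cons i l ih =>
    simp only [List.map_cons, List.prod_cons, List.sum_cons, mul_smul]
    rw [hx, ih, smul_comm, ← add_smul, add_comm]

end InducedModule

namespace Virasoro

/-- The basis of the Virasoro algebra formed by the `Lₙ` and the central element. -/
def stdBasis : Module.Basis (ℤ ⊕ Unit) ℂ Virasoro :=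
  (Finsupp.basisSingleOne (R := ℂ)).prod (Module.Basis.singleton Unit ℂ)

lemma stdBasis_inl (n : ℤ) : stdBasis (inl n) = L n :=
  Prod.ext
    ((Module.Basis.prod_apply_inl_fst (Finsupp.basisSingleOne (R := ℂ)) _ n).trans
      (congrFun Finsupp.coe_basisSingleOne n))
    (Module.Basis.prod_apply_inl_snd (Finsupp.basisSingleOne (R := ℂ)) _ n)

lemma stdBasis_inr (x : Unit) : stdBasis (inr x) = C :=
  Prod.ext
    (Module.Basis.prod_apply_inr_fst (Finsupp.basisSingleOne (R := ℂ)) _ x)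
    ((Module.Basis.prod_apply_inr_snd (Finsupp.basisSingleOne (R := ℂ)) _ x).trans
      (Module.Basis.singleton_apply Unit ℂ x))

/-- The number `m` such that the negative mode with index `i` is `L_{-m}`. -/
def degree (ε : ℤˣ) (i : ℕ) : ℤ := 3 * (i / 3 + 1 : ℕ) - ε * (1 - (i % 3 : ℕ))

lemma degree_eq_one (i : ℕ) : degree 1 i = i + 2 := by
  simp only [degree, Units.val_one]; push_cast; omega

lemma degree_eq_neg_one (i : ℕ) : degree (-1) i = 3 * (i / 3) + 4 - i % 3 := by
  simp only [degree, Units.val_neg, Units.val_one]; push_cast; omega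

lemma le_degree (ε : ℤˣ) (i : ℕ) : (i : ℤ) ≤ degree ε i ∧ 2 ≤ degree ε i := by
  rcases Int.units_eq_one_or ε with rfl | rfl
  · rw [degree_eq_one]; omega
  · rw [degree_eq_neg_one]; omega

lemma degree_injective (ε : ℤˣ) : Function.Injective (degree ε) := by
  intro i j hij
  rcases Int.units_eq_one_or ε with rfl | rfl
  · rw [degree_eq_one, degree_eq_one] at hij; omega
  · rw [degree_eq_neg_one, degree_eq_neg_one] at hij; omega

lemma exists_degree_eq (ε : ℤˣ) {m : ℤ} (hm : 2 ≤ m) : ∃ i, degree ε i = m := by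
  rcases Int.units_eq_one_or ε with rfl | rfl
  · exact ⟨(m - 2).toNat, by rw [degree_eq_one]; omega⟩
  · exact ⟨(3 * ((m - 2) / 3) + 2 - (m - 2) % 3).toNat, by rw [degree_eq_neg_one]; omega⟩

/-- The enumeration of the modes of the Virasoro algebra in which the modes `L_{-m}` with `2 ≤ m`
come first. -/
def modeEquiv (ε : ℤˣ) : ℕ ⊕ ({n : ℤ // -1 ≤ n} ⊕ Unit) ≃ ℤ ⊕ Unit :=
  (Equiv.sumAssoc _ _ _).symm.trans <| (Equiv.sumCongr
    (.ofBijective (Sum.elim (fun i => -degree ε i) Subtype.val) (by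
      constructor
      · rintro (i | ⟨n, hn⟩) (j | ⟨m, hm⟩) h
        · exact congrArg _ (degree_injective ε (neg_injective h))
        · have := (le_degree ε i).2; simp at h; omega
        · have := (le_degree ε j).2; simp at h; omega
        · exact congrArg _ (Subtype.ext h)
      · intro n
        by_cases hn : -1 ≤ n
        · exact ⟨inr ⟨n, hn⟩, rfl⟩
        · obtain ⟨i, hi⟩ := exists_degree_eq ε (m := -n) (by omega)
          exact ⟨inl i, by simp [hi]⟩)) (Equiv.refl Unit))

/-- The basis of the Virasoro algebra in which the modes `L_{-m}` with `2 ≤ m` come first. -/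
def basis (ε : ℤˣ) : Module.Basis (ℕ ⊕ ({n : ℤ // -1 ≤ n} ⊕ Unit)) ℂ Virasoro :=
  stdBasis.reindex (modeEquiv ε).symm

lemma basis_inl (ε : ℤˣ) (i : ℕ) : basis ε (inl i) = L (-degree ε i) := by
  rw [basis, Module.Basis.reindex_apply, Equiv.symm_symm]
  exact stdBasis_inl _

lemma basis_inr_inl (ε : ℤˣ) (n : {n : ℤ // -1 ≤ n}) : basis ε (inr (inl n)) = L n := by
  rw [basis, Module.Basis.reindex_apply, Equiv.symm_symm]
  exact stdBasis_inl _

lemma basis_inr_inr (ε : ℤˣ) (x : Unit) : basis ε (inr (inr x)) = C := by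
  rw [basis, Module.Basis.reindex_apply, Equiv.symm_symm]
  exact stdBasis_inr _

/-- The linear form `Lₙ ↦ 0`, `C ↦ c`. -/
def charge (c : ℂ) : Virasoro →ₗ[ℂ] ℂ := c • LinearMap.snd ℂ (ℤ →₀ ℂ) ℂ

lemma charge_L (c : ℂ) (n : ℤ) : charge c (L n) = 0 := mul_zero c

lemma charge_C (c : ℂ) : charge c C = c := mul_one c

lemma lie_C (x : Virasoro) : ⁅x, C⁆ = 0 := map_zero (wittBracket x.1)

lemma isCharacter (c : ℂ) (ε : ℤˣ) : IsCharacter (basis ε) (charge c) := by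
  rintro (⟨m, hm⟩ | x) (⟨n, hn⟩ | y)
  · have hz : (if m + n = 0 then ((m : ℂ) ^ 3 - m) / 12 else 0) = 0 := by
      split_ifs with h
      · obtain rfl | rfl | rfl : m = -1 ∨ m = 0 ∨ m = 1 := by omega
        all_goals norm_num
      · rfl
    simp only [basis_inr_inl, L_lie_L, hz, zero_smul, add_zero]
    refine ⟨?_, by rw [map_smul, charge_L, smul_zero]⟩
    by_cases hmn : -1 ≤ m + n
    · refine Submodule.smul_mem _ _ (Submodule.subset_span ⟨inl ⟨m + n, hmn⟩, ?_⟩)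
      exact basis_inr_inl ε _
    · obtain rfl : m = n := by omega
      simp
  · rw [basis_inr_inr, lie_C]; simp
  · rw [basis_inr_inr, ← lie_skew, lie_C]; simp
  · rw [basis_inr_inr, lie_C]; simp

variable (c : ℂ) (ε : ℤˣ)

lemma envRep_u_of_le {n : ℤ} (hn : -1 ≤ n) :
    envRep (isCharacter c ε) (u n) (z ℂ 0) = 0 := by
  rw [u, envRep_ι, ← basis_inr_inl ε ⟨n, hn⟩, act_z_zero_inr, basis_inr_inl, charge_L, zero_smul]

lemma envRep_C :
    envRep (isCharacter c ε) (UniversalEnvelopingAlgebra.ι ℂ C) (z ℂ 0) = c • z ℂ 0 := by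
  rw [envRep_ι, ← basis_inr_inr ε (), act_z_zero_inr, basis_inr_inr, charge_C]

/-- The evaluation of the enveloping algebra at the empty monomial. -/
def evalU : U →ₗ[ℂ] Mon ℂ ℕ :=
  (LinearMap.applyₗ (z ℂ 0)).comp (envRep (isCharacter c ε)).toLinearMap

lemma evalU_apply (a : U) : evalU c ε a = envRep (isCharacter c ε) a (z ℂ 0) := rfl

lemma evalU_mul (a a' : U) : evalU c ε (a * a') = envRep (isCharacter c ε) a (evalU c ε a') := by
  simp [evalU_apply]

lemma evalU_vermaIdeal {a : U} (ha : a ∈ vermaIdeal c 0) : evalU c ε a = 0 := by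
  induction ha using Submodule.span_induction with
  | zero => simp
  | add x y _ _ hx hy => rw [map_add, hx, hy, add_zero]
  | smul a x _ hx => rw [smul_eq_mul, evalU_mul, hx, map_zero]
  | mem x hx =>
    rcases hx with ⟨n, hn, rfl⟩ | rfl | rfl
    · exact envRep_u_of_le c ε (by omega)
    · rw [map_zero, sub_zero]
      exact envRep_u_of_le c ε (by omega)
    · rw [map_sub, evalU_apply, evalU_apply, envRep_C, AlgHom.commutes,
        Module.algebraMap_end_apply, sub_self]

/-- The evaluation of the Verma module at the empty monomial. -/
def evalVerma : Verma c 0 →ₗ[ℂ] Mon ℂ ℕ :=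
  ((vermaIdeal c 0).restrictScalars ℂ).liftQ (evalU c ε) fun _ ha => evalU_vermaIdeal c ε ha

lemma evalVerma_mk (a : U) : evalVerma c ε (Submodule.Quotient.mk a) = evalU c ε a := rfl

lemma evalVerma_smul (a : U) (v : Verma c 0) :
    evalVerma c ε (a • v) = envRep (isCharacter c ε) a (evalVerma c ε v) := by
  obtain ⟨a', rfl⟩ := Submodule.Quotient.mk_surjective _ v
  rw [← Submodule.Quotient.mk_smul, evalVerma_mk, evalVerma_mk, smul_eq_mul, evalU_mul]

lemma evalVerma_singularSubmodule {v : Verma c 0} (hv : v ∈ singularSubmodule c) :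
    evalVerma c ε v = 0 := by
  obtain ⟨a, rfl⟩ := Submodule.mem_span_singleton.mp hv
  rw [evalVerma_smul, evalVerma_smul, highestWeightVector, evalVerma_mk, evalU_apply, map_one,
    Module.End.one_apply, envRep_u_of_le c ε le_rfl, map_zero]

/-- The evaluation of the universal Virasoro vertex operator algebra at the empty monomial. -/
def eval : UniversalVOA c →ₗ[ℂ] Mon ℂ ℕ :=
  ((singularSubmodule c).restrictScalars ℂ).liftQ (evalVerma c ε)
    fun _ hv => evalVerma_singularSubmodule c ε hv

lemma eval_smul_vacuum (a : U) :
    eval c ε (a • vacuum c) = envRep (isCharacter c ε) a (z ℂ 0) := by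
  change evalVerma c ε (a • highestWeightVector c 0) = _
  rw [evalVerma_smul, highestWeightVector, evalVerma_mk, evalU_apply, map_one,
    Module.End.one_apply]

lemma exists_smul_vacuum (v : UniversalVOA c) : ∃ a : U, a • vacuum c = v := by
  obtain ⟨w, rfl⟩ := Submodule.Quotient.mk_surjective _ v
  obtain ⟨a, rfl⟩ := Submodule.Quotient.mk_surjective _ w
  refine ⟨a, ?_⟩
  rw [vacuum, ← Submodule.Quotient.mk_smul, highestWeightVector, ← Submodule.Quotient.mk_smul,
    smul_eq_mul, mul_one]

lemma mk_smul_vacuum_of_mem {a : U} (ha : a ∈ vermaIdeal c 0) : a • vacuum c = 0 := by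
  rw [vacuum, ← Submodule.Quotient.mk_smul, highestWeightVector, ← Submodule.Quotient.mk_smul,
    smul_eq_mul, mul_one, (Submodule.Quotient.mk_eq_zero _).mpr ha, Submodule.Quotient.mk_zero]

lemma u_smul_vacuum {n : ℤ} (hn : -1 ≤ n) : u n • vacuum c = 0 := by
  rcases hn.eq_or_lt with rfl | hn
  · rw [vacuum, ← Submodule.Quotient.mk_smul, Submodule.Quotient.mk_eq_zero]
    exact Submodule.mem_span_singleton_self _
  · refine mk_smul_vacuum_of_mem c ?_
    rcases (show 0 ≤ n by omega).eq_or_lt with rfl | hn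
    · exact Ideal.subset_span (Or.inr (Or.inl (by simp)))
    · exact Ideal.subset_span (Or.inl ⟨n, hn, rfl⟩)

lemma C_smul_vacuum : UniversalEnvelopingAlgebra.ι ℂ C • vacuum c = c • vacuum c := by
  have := mk_smul_vacuum_of_mem c (a := UniversalEnvelopingAlgebra.ι ℂ C - algebraMap ℂ U c)
    (Ideal.subset_span (Or.inr (Or.inr rfl)))
  rwa [sub_smul, algebraMap_smul, sub_eq_zero] at this

lemma ι_smul_vacuum (s : {n : ℤ // -1 ≤ n} ⊕ Unit) :
    UniversalEnvelopingAlgebra.ι ℂ (basis ε (inr s)) • vacuum c =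
      charge c (basis ε (inr s)) • vacuum c := by
  rcases s with n | x
  · rw [basis_inr_inl, charge_L, zero_smul]
    exact u_smul_vacuum c n.2
  · rw [basis_inr_inr, charge_C, C_smul_vacuum]

/-- The basis of the universal Virasoro vertex operator algebra formed by the ordered monomials. -/
def monomialBasis : Module.Basis (Multiset ℕ) ℂ (UniversalVOA c) :=
  InducedModule.basis (isCharacter c ε) (vacuum c) (ι_smul_vacuum c ε) (exists_smul_vacuum c)
    (eval c ε) (eval_smul_vacuum c ε)

lemma monomialBasis_apply (A : Multiset ℕ) :
    monomialBasis c ε A = (A.sort.map fun i => u (-degree ε i)).prod • vacuum c := by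
  rw [monomialBasis, InducedModule.basis_apply, word]
  simp only [basis_inl, u]

lemma u_mul_u (m n : ℤ) :
    u m * u n = u n * u m + ((m : ℂ) - n) • u (m + n) +
      (if m + n = 0 then ((m : ℂ) ^ 3 - m) / 12 else 0) • UniversalEnvelopingAlgebra.ι ℂ C := by
  rw [u, u, ι_mul_ι, L_lie_L, map_add, map_smul, map_smul, add_assoc, u]

lemma L0_u_smul {m : ℤ} (hm : m ≠ 0) (v : UniversalVOA c) :
    L0 c (u m • v) = u m • L0 c v + (-m : ℂ) • u m • v := by
  change u 0 • u m • v = u m • u 0 • v + (-m : ℂ) • u m • v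
  rw [← mul_smul, u_mul_u, if_neg (by omega), zero_smul, add_zero, add_smul, mul_smul, smul_assoc,
    Int.cast_zero, zero_sub, zero_add]

lemma L0_vacuum : L0 c (vacuum c) = 0 := u_smul_vacuum c (by norm_num)

lemma L0_monomialBasis (A : Multiset ℕ) :
    L0 c (monomialBasis c ε A) = ((A.map fun i => (degree ε i : ℂ)).sum) • monomialBasis c ε A := by
  rw [monomialBasis_apply]
  refine weight_prod_smul (L0_vacuum c) (fun i w => ?_) A
  have := (le_degree ε i).2
  rw [L0_u_smul c (by omega), Int.cast_neg, neg_neg]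

end Virasoro
end

noncomputable section

open Sum InducedModule
open scoped TensorProduct

namespace AffineSl2

/-- The standard basis of `sl₂` as a family. -/
def gen : Fin 3 → Sl2 := ![e, h, f]

/-- The coordinates on `sl₂` with respect to `e`, `h`, `f`. -/
def sl2Coord : Sl2 ≃ₗ[ℂ] (Fin 3 → ℂ) where
  toFun A := ![A.val 0 1, A.val 0 0, A.val 1 0]
  map_add' A B := by ext i; fin_cases i <;> simp
  map_smul' r A := by ext i; fin_cases i <;> simp
  invFun v := v 0 • e + v 1 • h + v 2 • f
  left_inv A := by
    have hA : A.val 0 0 + A.val 1 1 = 0 := by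
      have := LinearMap.mem_ker.mp A.property
      simpa [Matrix.trace_fin_two] using this
    ext i j
    fin_cases i <;> fin_cases j <;> simp [e, h, f]
    linear_combination -hA
  right_inv v := by ext i; fin_cases i <;> simp [e, h, f]

/-- The basis `e`, `h`, `f` of `sl₂`. -/
def sl2Basis : Module.Basis (Fin 3) ℂ Sl2 := .ofEquivFun sl2Coord

lemma sl2Basis_apply (i : Fin 3) : sl2Basis i = gen i := by
  rw [sl2Basis, Module.Basis.coe_ofEquivFun]
  fin_cases i <;> simp [sl2Coord, gen]

lemma mode_add (x y : Sl2) (n : ℤ) : mode (x + y) n = mode x n + mode y n := by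
  simp only [mode, ← LieAlgebra.of_add, TensorProduct.tmul_add, Prod.mk_add_mk, add_zero]

lemma mode_smul (r : ℂ) (x : Sl2) (n : ℤ) : mode (r • x) n = r • mode x n := by
  simp only [mode, ← LieAlgebra.of_smul, TensorProduct.tmul_smul, Prod.smul_mk, smul_zero]

lemma h_lie_e : ⁅h, e⁆ = (2 : ℂ) • e := by
  refine Subtype.ext ?_
  rw [LieAlgebra.SpecialLinear.sl_bracket]
  ext i j
  fin_cases i <;> fin_cases j <;> simp [e, h, Matrix.mul_apply]; norm_num

lemma h_lie_f : ⁅h, f⁆ = (-2 : ℂ) • f := by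
  refine Subtype.ext ?_
  rw [LieAlgebra.SpecialLinear.sl_bracket]
  ext i j
  fin_cases i <;> fin_cases j <;> simp [f, h, Matrix.mul_apply]; norm_num

lemma e_lie_f : ⁅e, f⁆ = h := by
  refine Subtype.ext ?_
  rw [LieAlgebra.SpecialLinear.sl_bracket]
  ext i j
  fin_cases i <;> fin_cases j <;> simp [e, f, h]

lemma form_e_e : form e e = 0 := by
  simp [form_apply, e]

lemma form_f_f : form f f = 0 := by
  simp [form_apply, f]

lemma form_e_f : form e f = 1 := by
  simp [form_apply, e, f]

lemma form_h_h : form h h = 2 := by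
  simp [form_apply, h, Matrix.trace_fin_two, Matrix.mul_apply]; norm_num

lemma form_h_e : form h e = 0 := by
  simp [form_apply, e, h, Matrix.trace_fin_two, Matrix.mul_apply]

lemma form_h_f : form h f = 0 := by
  simp [form_apply, f, h, Matrix.trace_fin_two, Matrix.mul_apply]

/-- The affine Lie algebra as a vector space. -/
def toProd : AffineLie ≃ₗ[ℂ] Loop × ℂ where
  toFun x := (((LieAlgebra.ofProd cocycle).symm x).1,
    TrivialLieModule.equiv ℂ Loop ℂ ((LieAlgebra.ofProd cocycle).symm x).2)
  map_add' x y := by simp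
  map_smul' r x := by simp
  invFun p := LieAlgebra.ofProd cocycle (p.1, (TrivialLieModule.equiv ℂ Loop ℂ).symm p.2)
  left_inv x := by simp
  right_inv x := by simp

/-- The basis of the affine Lie algebra formed by the modes of `e`, `h`, `f` and `K`. -/
def stdBasis : Module.Basis ((ℤ × Fin 3) ⊕ Unit) ℂ AffineLie :=
  (((AddMonoidAlgebra.basis ℤ ℂ).tensorProduct sl2Basis).prod
    (Module.Basis.singleton Unit ℂ)).map toProd.symm

lemma stdBasis_inl (n : ℤ) (i : Fin 3) : stdBasis (inl (n, i)) = mode (gen i) n := by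
  rw [stdBasis, Module.Basis.map_apply, Module.Basis.prod_apply, Sum.elim_inl,
    Function.comp_apply, Module.Basis.tensorProduct_apply, sl2Basis_apply]
  simp [toProd, mode]

lemma stdBasis_inr (x : Unit) : stdBasis (inr x) = K := by
  rw [stdBasis, Module.Basis.map_apply, Module.Basis.prod_apply, Sum.elim_inr,
    Function.comp_apply, Module.Basis.singleton_apply]
  simp [toProd, K]

/-- The residue of `i` modulo three. -/
def residue (i : ℕ) : Fin 3 := ⟨i % 3, Nat.mod_lt _ (by norm_num)⟩

/-- The enumeration of the basis in which the negative modes come first. -/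
def modeEquiv : ℕ ⊕ (({n : ℤ // 0 ≤ n} × Fin 3) ⊕ Unit) ≃ (ℤ × Fin 3) ⊕ Unit :=
  (Equiv.sumAssoc _ _ _).symm.trans <| (Equiv.sumCongr
    (.ofBijective (Sum.elim (fun i : ℕ => (-((i / 3 + 1 : ℕ) : ℤ), residue i))
      (fun p => (p.1.1, p.2))) (by
      constructor
      · rintro (i | ⟨⟨n, hn⟩, a⟩) (j | ⟨⟨m, hm⟩, b⟩) hij
        · simp [residue] at hij; rw [show i = j by omega]
        · simp at hij; omega
        · simp at hij; omega
        · simp at hij; simp [hij]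
      · rintro ⟨n, a⟩
        by_cases hn : 0 ≤ n
        · exact ⟨inr (⟨n, hn⟩, a), rfl⟩
        · refine ⟨inl (3 * (-n - 1).toNat + a), Prod.ext ?_ (Fin.ext ?_)⟩
          · simp only [Sum.elim_inl]; omega
          · simp [residue])) (Equiv.refl Unit))

/-- The basis of the affine Lie algebra in which the negative modes come first. -/
def basis : Module.Basis (ℕ ⊕ (({n : ℤ // 0 ≤ n} × Fin 3) ⊕ Unit)) ℂ AffineLie :=
  stdBasis.reindex modeEquiv.symm

lemma basis_inl (i : ℕ) : basis (inl i) = mode (gen (residue i)) (-((i / 3 + 1 : ℕ) : ℤ)) := by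
  rw [basis, Module.Basis.reindex_apply, Equiv.symm_symm]
  exact stdBasis_inl _ _

lemma basis_inr_inl (n : {n : ℤ // 0 ≤ n}) (i : Fin 3) :
    basis (inr (inl (n, i))) = mode (gen i) n := by
  rw [basis, Module.Basis.reindex_apply, Equiv.symm_symm]
  exact stdBasis_inl _ _

lemma basis_inr_inr (x : Unit) : basis (inr (inr x)) = K := by
  rw [basis, Module.Basis.reindex_apply, Equiv.symm_symm]
  exact stdBasis_inr _

/-- The linear form `xₙ ↦ 0`, `K ↦ k`. -/
def level (k : ℂ) : AffineLie →ₗ[ℂ] ℂ :=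
  k • (LinearMap.snd ℂ Loop ℂ).comp toProd.toLinearMap

lemma level_mode (k : ℂ) (x : Sl2) (n : ℤ) : level k (mode x n) = 0 := by
  simp [level, toProd, mode]

lemma level_K (k : ℂ) : level k K = k := by
  simp [level, toProd, K]

lemma mode_mem_span (x : Sl2) {n : ℤ} (hn : 0 ≤ n) :
    mode x n ∈ Submodule.span ℂ (Set.range fun s => basis (inr s)) := by
  have hx := sl2Basis.mem_span x
  induction hx using Submodule.span_induction with
  | mem x hx =>
    obtain ⟨i, rfl⟩ := hx
    rw [sl2Basis_apply]
    exact Submodule.subset_span ⟨inl (⟨n, hn⟩, i), basis_inr_inl _ _⟩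
  | zero => rw [show mode 0 n = 0 by simpa using mode_smul 0 0 n]; exact zero_mem _
  | add x y _ _ hx hy => rw [mode_add]; exact add_mem hx hy
  | smul r x _ hx => rw [mode_smul]; exact Submodule.smul_mem _ r hx

lemma isCharacter (k : ℂ) : IsCharacter basis (level k) := by
  rintro (⟨⟨m, hm⟩, i⟩ | x) (⟨⟨n, hn⟩, j⟩ | y)
  · have hz : (if m + n = 0 then (m : ℂ) * form (gen i) (gen j) else 0) = 0 := by
      split_ifs with hmn
      · obtain rfl : m = 0 := by omega
        simp
      · rfl
    simp only [basis_inr_inl, mode_lie_mode, hz, zero_smul, add_zero]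
    exact ⟨mode_mem_span _ (by omega), level_mode k _ _⟩
  · rw [basis_inr_inr, lie_K]; simp
  · rw [basis_inr_inr, ← lie_skew, lie_K]; simp
  · rw [basis_inr_inr, lie_K]; simp

variable (k : ℂ)

/-- The evaluation of the enveloping algebra at the empty monomial. -/
def evalU : U →ₗ[ℂ] Mon ℂ ℕ :=
  (LinearMap.applyₗ (z ℂ 0)).comp (envRep (isCharacter k)).toLinearMap

lemma evalU_apply (a : U) : evalU k a = envRep (isCharacter k) a (z ℂ 0) := rfl

lemma evalU_vacuumIdeal {a : U} (ha : a ∈ vacuumIdeal k) : evalU k a = 0 := by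
  induction ha using Submodule.span_induction with
  | zero => simp
  | add x y _ _ hx hy => rw [map_add, hx, hy, add_zero]
  | smul a x _ hx =>
    rw [evalU_apply] at hx ⊢
    rw [smul_eq_mul, map_mul, Module.End.mul_apply, hx, map_zero]
  | mem x hx =>
    rcases hx with ⟨x, n, hn, rfl⟩ | rfl
    · rw [evalU_apply, u, envRep_ι, act_z_zero_of_mem (mode_mem_span x hn), level_mode, zero_smul]
    · rw [map_sub, evalU_apply, evalU_apply, envRep_ι, ← basis_inr_inr (), act_z_zero_inr,
        basis_inr_inr, level_K, AlgHom.commutes, Module.algebraMap_end_apply, sub_self]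

/-- The evaluation of the universal affine vertex operator algebra at the empty monomial. -/
def eval : UniversalVOA k →ₗ[ℂ] Mon ℂ ℕ :=
  ((vacuumIdeal k).restrictScalars ℂ).liftQ (evalU k) fun _ ha => evalU_vacuumIdeal k ha

lemma smul_vacuum (a : U) : a • vacuum k = Submodule.Quotient.mk a := by
  rw [vacuum, ← Submodule.Quotient.mk_smul, smul_eq_mul, mul_one]

lemma eval_smul_vacuum (a : U) :
    eval k (a • vacuum k) = envRep (isCharacter k) a (z ℂ 0) := by
  rw [smul_vacuum]
  rfl

lemma exists_smul_vacuum (v : UniversalVOA k) : ∃ a : U, a • vacuum k = v := by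
  obtain ⟨a, rfl⟩ := Submodule.Quotient.mk_surjective _ v
  exact ⟨a, smul_vacuum k a⟩

lemma K_smul_vacuum : UniversalEnvelopingAlgebra.ι ℂ K • vacuum k = k • vacuum k := by
  have : (UniversalEnvelopingAlgebra.ι ℂ K - algebraMap ℂ U k) • vacuum k = 0 := by
    rw [smul_vacuum, Submodule.Quotient.mk_eq_zero]
    exact Ideal.subset_span (Or.inr rfl)
  rwa [sub_smul, algebraMap_smul, sub_eq_zero] at this

lemma ι_smul_vacuum (s : ({n : ℤ // 0 ≤ n} × Fin 3) ⊕ Unit) :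
    UniversalEnvelopingAlgebra.ι ℂ (basis (inr s)) • vacuum k =
      level k (basis (inr s)) • vacuum k := by
  rcases s with ⟨n, i⟩ | x
  · rw [basis_inr_inl, level_mode, zero_smul]
    exact u_smul_vacuum k _ n.2
  · rw [basis_inr_inr, level_K, K_smul_vacuum]

/-- The basis of the universal affine vertex operator algebra formed by the ordered monomials. -/
def monomialBasis : Module.Basis (Multiset ℕ) ℂ (UniversalVOA k) :=
  InducedModule.basis (isCharacter k) (vacuum k) (ι_smul_vacuum k) (exists_smul_vacuum k)
    (eval k) (eval_smul_vacuum k)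

lemma monomialBasis_apply (A : Multiset ℕ) :
    monomialBasis k A =
      (A.sort.map fun i => u (gen (residue i)) (-((i / 3 + 1 : ℕ) : ℤ))).prod • vacuum k := by
  rw [monomialBasis, InducedModule.basis_apply, word]
  simp only [basis_inl, u]

end AffineSl2
end

noncomputable section

open Sum InducedModule

namespace AffineSl2

/-- The Casimir element with the two tensor factors in degrees `p` and `q`. -/
def casimir (p q : ℤ) : U := u e p * u f q + u f p * u e q + (1 / 2 : ℂ) • (u h p * u h q)

/-- The antisymmetric tensor `∑ a ⊗ [b, x]`, where `∑ a ⊗ b` is the Casimir tensor and `x` is the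
standard generator with index `i`, with the two tensor factors in degrees `p` and `q`. -/
def adCasimir (i : Fin 3) (p q : ℤ) : U :=
  ![u h p * u e q - u e p * u h q, (2 : ℂ) • (u e p * u f q - u f p * u e q),
    u f p * u h q - u h p * u f q] i

lemma casimirTerm_eq (n : ℕ) : casimirTerm n = casimir (-n) n := rfl

lemma u_smul (r : ℂ) (x : Sl2) (n : ℤ) : u (r • x) n = r • u x n := by
  rw [u, u, mode_smul, map_smul]

lemma u_neg (x : Sl2) (n : ℤ) : u (-x) n = -u x n := by
  rw [← neg_one_smul ℂ, u_smul, neg_one_smul]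

lemma u_zero (n : ℤ) : u 0 n = 0 := by
  simpa using u_smul 0 0 n

lemma f_lie_h : ⁅f, h⁆ = (2 : ℂ) • f := by
  rw [← lie_skew, h_lie_f, neg_smul, neg_neg]

lemma e_lie_h : ⁅e, h⁆ = (-2 : ℂ) • e := by
  rw [← lie_skew, h_lie_e, neg_smul]

lemma f_lie_e : ⁅f, e⁆ = -h := by
  rw [← lie_skew, e_lie_f]

lemma form_f_e : form f e = 1 := (form_isSymm.eq _ _).trans form_e_f

lemma form_e_h : form e h = 0 := (form_isSymm.eq _ _).trans form_h_e

lemma form_f_h : form f h = 0 := (form_isSymm.eq _ _).trans form_h_f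

lemma mul_mul_comm_of {A : Type*} [Ring A] {a b c r s : A} (hb : b * c = c * b + r)
    (ha : a * c = c * a + s) : a * b * c = c * (a * b) + (a * r + s * b) := by
  rw [mul_assoc, hb, mul_add, ← mul_assoc, ha, add_mul, mul_assoc]
  abel

/-- The scalar `p δ_{p+m,0}`. -/
def delta (p m : ℤ) : ℂ := if p + m = 0 then p else 0

lemma u_mul_u' (x y : Sl2) (m n : ℤ) :
    u x m * u y n = u y n * u x m + (u ⁅x, y⁆ (m + n) +
      (delta m n * form x y) • UniversalEnvelopingAlgebra.ι ℂ K) := by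
  rw [u_mul_u, add_assoc, delta, ite_mul, zero_mul]

lemma casimir_mul_u (i : Fin 3) (p q m : ℤ) :
    casimir p q * u (gen i) m = u (gen i) m * casimir p q + (adCasimir i p (q + m) -
      adCasimir i (p + m) q + (delta q m • (u (gen i) p * UniversalEnvelopingAlgebra.ι ℂ K) +
        delta p m • (u (gen i) q * UniversalEnvelopingAlgebra.ι ℂ K))) := by
  rw [casimir, add_mul, add_mul, smul_mul_assoc,
    mul_mul_comm_of (u_mul_u' f (gen i) q m) (u_mul_u' e (gen i) p m),
    mul_mul_comm_of (u_mul_u' e (gen i) q m) (u_mul_u' f (gen i) p m),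
    mul_mul_comm_of (u_mul_u' h (gen i) q m) (u_mul_u' h (gen i) p m)]
  fin_cases i <;>
    simp only [gen, adCasimir, Fin.zero_eta, Fin.mk_one, Fin.reduceFinMk, Fin.isValue,
      Matrix.cons_val, lie_self, h_lie_e, h_lie_f,
      e_lie_f, f_lie_h, e_lie_h, f_lie_e, form_e_e, form_f_f, form_e_f, form_h_h, form_h_e,
      form_h_f, form_f_e, form_e_h, form_f_h, u_zero, u_neg, u_smul, mul_zero, mul_one, zero_smul,
      add_zero, zero_add, mul_add, add_mul, smul_mul_assoc, mul_smul_comm, zero_mul, mul_neg,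
      neg_mul, smul_add, smul_sub, smul_smul, u_mul_K]
  all_goals module

lemma adCasimir_symm (i : Fin 3) {p q : ℤ} (hpq : p + q ≠ 0) :
    adCasimir i p q + adCasimir i q p = (4 : ℂ) • u (gen i) (p + q) := by
  have hqp : q + p ≠ 0 := by omega
  fin_cases i <;>
    simp only [gen, adCasimir, Fin.zero_eta, Fin.mk_one, Fin.reduceFinMk, Fin.isValue,
      Matrix.cons_val]
  · rw [u_mul_u h e p q, u_mul_u h e q p, if_neg hpq, if_neg hqp, h_lie_e, u_smul, u_smul,
      add_comm q p]
    module
  · rw [u_mul_u e f p q, u_mul_u e f q p, if_neg hpq, if_neg hqp, e_lie_f, add_comm q p]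
    module
  · rw [u_mul_u f h p q, u_mul_u f h q p, if_neg hpq, if_neg hqp, f_lie_h, u_smul, u_smul,
      add_comm q p]
    module

variable (k : ℂ)

lemma K_mul (a : U) : UniversalEnvelopingAlgebra.ι ℂ K * a = a * UniversalEnvelopingAlgebra.ι ℂ K := by
  induction a using env_induction with
  | halg r => exact (Algebra.commutes r _).symm
  | hι x => rw [ι_mul_ι, ← lie_skew, lie_K, neg_zero, map_zero, add_zero]
  | hadd a a' h h' => rw [mul_add, add_mul, h, h']
  | hmul a a' h h' => rw [← mul_assoc, h, mul_assoc, h', mul_assoc]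

lemma K_smul (v : UniversalVOA k) : UniversalEnvelopingAlgebra.ι ℂ K • v = k • v := by
  obtain ⟨a, rfl⟩ := exists_smul_vacuum k v
  rw [← mul_smul, K_mul, mul_smul, K_smul_vacuum, smul_algebra_smul_comm]

lemma adCasimir_smul_eq_zero (i : Fin 3) {p q : ℤ} {v : UniversalVOA k}
    (hv : ∀ x, u x q • v = 0) : adCasimir i p q • v = 0 := by
  fin_cases i <;> simp [adCasimir, sub_smul, mul_smul, smul_assoc, hv]

lemma casimirTerm_smul_eq_zero {n : ℕ} {v : UniversalVOA k}
    (hv : ∀ x, u x n • v = 0) : casimirTerm n • v = 0 := by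
  simp only [casimirTerm, add_smul, smul_assoc, mul_smul, hv, smul_zero, add_zero]

lemma exists_forall_smul_eq_zero (v : UniversalVOA k) :
    ∃ N : ℕ, ∀ n : ℤ, N ≤ n → ∀ x, u x n • v = 0 := mem_smoothPart k v

lemma L0_apply {N : ℕ} {v : UniversalVOA k} (hv : ∀ n : ℤ, N ≤ n → ∀ x, u x n • v = 0) :
    L0 k v = (1 / (2 * (k + 2))) • (casimirTerm 0 • v +
      (2 : ℂ) • ∑ n ∈ Finset.range N, casimirTerm (n + 1) • v) := by
  have : ∑ᶠ n : ℕ, casimirTerm (n + 1) • v = ∑ n ∈ Finset.range N, casimirTerm (n + 1) • v := by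
    refine finsum_eq_sum_of_support_subset _ fun n hn => ?_
    rw [Finset.coe_range, Set.mem_Iio]
    by_contra hlt
    exact hn (casimirTerm_smul_eq_zero k (hv _ (by push_cast; omega)))
  rw [← this]
  rfl

lemma L0_vacuum : L0 k (vacuum k) = 0 := by
  rw [L0_apply k (N := 0) fun n hn x => u_smul_vacuum k x (by simpa using hn),
    casimirTerm_smul_eq_zero k fun x => u_smul_vacuum k x (by simp)]
  simp

/-- The term `D(-n, n - r)` of the telescoping sum. -/
def boundary (i : Fin 3) (r n : ℕ) (v : UniversalVOA k) : UniversalVOA k :=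
  adCasimir i (-n) (n - r) • v

lemma casimirTerm_smul_u_smul (i : Fin 3) {r : ℕ} (hr : r ≠ 0) (n : ℕ) (v : UniversalVOA k) :
    casimirTerm n • u (gen i) (-r) • v = u (gen i) (-r) • casimirTerm n • v +
      (boundary k i r n v - boundary k i r (n + r) v +
        if n = r then (r * k : ℂ) • u (gen i) (-r) • v else 0) := by
  rw [← mul_smul, casimirTerm_eq, casimir_mul_u, add_smul, add_smul, sub_smul, mul_smul]
  have h1 : delta (-n) (-r) = 0 := if_neg (by omega)
  have h2 : (delta n (-r) • (u (gen i) (-n) * UniversalEnvelopingAlgebra.ι ℂ K)) • v =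
      if n = r then (r * k : ℂ) • u (gen i) (-r) • v else 0 := by
    split_ifs with hnr
    · rw [hnr, delta, if_pos (by omega), smul_assoc, mul_smul, K_smul, smul_algebra_smul_comm,
        ← mul_smul]
      norm_num
    · rw [delta, if_neg (by omega), zero_smul, zero_smul]
  rw [h1, zero_smul, add_zero, h2, boundary, boundary]
  congr 5 <;> push_cast <;> ring

lemma boundary_add {i : Fin 3} {r a b : ℕ} (hr : r ≠ 0) (hab : a + b = r) (v : UniversalVOA k) :
    boundary k i r a v + boundary k i r b v = (4 : ℂ) • u (gen i) (-r) • v := by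
  subst hab
  rw [boundary, boundary, ← add_smul, show ((a : ℤ) - (a + b : ℕ)) = -b by push_cast; ring,
    show ((b : ℤ) - (a + b : ℕ)) = -a by push_cast; ring, adCasimir_symm _ (by omega), smul_assoc]
  congr 3
  push_cast; ring

lemma sum_range_sub_shift {M : Type*} [AddCommGroup M] (g : ℕ → M) (r N : ℕ)
    (hg : ∀ n, N < n → g n = 0) :
    ∑ n ∈ Finset.range N, (g (n + 1) - g (n + 1 + r)) = ∑ n ∈ Finset.range r, g (n + 1) := by
  have h1 := Finset.sum_range_add (fun n => g (n + 1)) N r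
  have h2 := Finset.sum_range_add (fun n => g (n + 1)) r N
  have h3 : ∑ n ∈ Finset.range r, g (N + n + 1) = 0 :=
    Finset.sum_eq_zero fun n _ => hg _ (by omega)
  have h4 : ∑ n ∈ Finset.range N, g (n + 1 + r) = ∑ n ∈ Finset.range N, g (r + n + 1) :=
    Finset.sum_congr rfl fun n _ => congrArg g (by omega)
  rw [h3, add_zero, add_comm N r, h2] at h1
  rw [Finset.sum_sub_distrib, h4, ← h1, add_sub_cancel_right]

lemma sum_boundary (i : Fin 3) {r : ℕ} (hr : r ≠ 0) (v : UniversalVOA k) :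
    boundary k i r 0 v - boundary k i r r v +
      (2 : ℂ) • ∑ n ∈ Finset.range r, boundary k i r (n + 1) v =
      (4 * r : ℂ) • u (gen i) (-r) • v := by
  set g := fun n => boundary k i r n v with hg
  have h1 := Finset.sum_range_succ' g r
  have h2 := Finset.sum_range_succ g r
  have h3 : ∑ n ∈ Finset.range r, g (n + 1) + ∑ n ∈ Finset.range r, g n =
      (4 * r : ℂ) • u (gen i) (-r) • v := by
    rw [← Finset.sum_range_reflect, ← Finset.sum_add_distrib, Finset.sum_congr rfl
      fun n hn => ?_, Finset.sum_const, Finset.card_range, ← Nat.cast_smul_eq_nsmul ℂ, mul_comm,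
      mul_smul]
    rw [Finset.mem_range] at hn
    exact boundary_add k hr (by omega) v
  rw [← h3, two_smul]
  rw [h1] at h2
  change g 0 - g r + (∑ n ∈ Finset.range r, g (n + 1) + ∑ n ∈ Finset.range r, g (n + 1)) = _
  have h4 : g 0 - g r + ∑ n ∈ Finset.range r, g (n + 1) = ∑ n ∈ Finset.range r, g n := by
    rw [sub_add_eq_add_sub, add_comm (g 0), h2, add_sub_cancel_right]
  rw [← add_assoc, h4, add_comm]

lemma L0_u_smul (hk : k ≠ -2) (i : Fin 3) {r : ℕ} (hr : r ≠ 0) (v : UniversalVOA k) :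
    L0 k (u (gen i) (-r) • v) = u (gen i) (-r) • L0 k v + (r : ℂ) • u (gen i) (-r) • v := by
  obtain ⟨N₁, hN₁⟩ := exists_forall_smul_eq_zero k v
  obtain ⟨N₂, hN₂⟩ := exists_forall_smul_eq_zero k (u (gen i) (-r) • v)
  set N := N₁ + N₂ + r with hN
  have hsum : ∑ n ∈ Finset.range N, casimirTerm (n + 1) • u (gen i) (-r) • v =
      u (gen i) (-r) • ∑ n ∈ Finset.range N, casimirTerm (n + 1) • v +
        (∑ n ∈ Finset.range r, boundary k i r (n + 1) v + (r * k : ℂ) • u (gen i) (-r) • v) := by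
    rw [Finset.sum_congr rfl fun n _ => casimirTerm_smul_u_smul k i hr (n + 1) v,
      Finset.sum_add_distrib, Finset.sum_add_distrib, Finset.smul_sum,
      sum_range_sub_shift (fun n => boundary k i r n v)]
    · obtain ⟨s, rfl⟩ := Nat.exists_eq_succ_of_ne_zero hr
      simp only [Nat.succ_eq_add_one, add_left_inj]
      rw [Finset.sum_ite_eq' (Finset.range N) s, if_pos (by simp; omega)]
    · exact fun n hn => adCasimir_smul_eq_zero k i fun x => hN₁ _ (by omega) x
  rw [L0_apply k (N := N) fun n hn x => hN₁ n (by omega) x,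
    L0_apply k (N := N) fun n hn x => hN₂ n (by omega) x, hsum,
    casimirTerm_smul_u_smul k i hr 0 v, if_neg (Ne.symm hr), add_zero, zero_add,
    smul_algebra_smul_comm, smul_add (u (gen i) (-r)), smul_algebra_smul_comm]
  have hb := sum_boundary k i hr v
  have hk' : k + 2 ≠ 0 := fun h => hk (eq_neg_of_add_eq_zero_left h)
  have hr' : (r : ℂ) • u (gen i) (-r) • v = (1 / (2 * (k + 2))) •
      ((4 * r : ℂ) • u (gen i) (-r) • v + (2 : ℂ) • (r * k : ℂ) • u (gen i) (-r) • v) := by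
    rw [smul_smul 2, ← add_smul, smul_smul]
    congr 1
    field_simp
    ring
  rw [hr', ← hb, ← smul_add]
  congr 1
  rw [smul_add (2 : ℂ), smul_add (2 : ℂ)]
  abel

lemma h0_u_smul (i : Fin 3) (n : ℤ) (v : UniversalVOA k) :
    h0 k (u (gen i) n • v) = u (gen i) n • h0 k v + (2 - 2 * (i : ℕ) : ℂ) • u (gen i) n • v := by
  change u h 0 • u (gen i) n • v = u (gen i) n • u h 0 • v + (2 - 2 * (i : ℕ) : ℂ) • u (gen i) n • v
  have hl : ⁅h, gen i⁆ = (2 - 2 * (i : ℕ) : ℂ) • gen i := by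
    fin_cases i
    · simp [gen, h_lie_e]
    · simp [gen]
    · simp only [gen, Fin.reduceFinMk, Matrix.cons_val, h_lie_f]; norm_num
  rw [← mul_smul, u_mul_u, hl, u_smul, zero_add, Int.cast_zero, zero_mul, ite_self, zero_smul,
    add_zero, add_smul, mul_smul, smul_assoc]

lemma h0_vacuum : h0 k (vacuum k) = 0 := u_smul_vacuum k h le_rfl

/-- The `h₀`-weight of the negative mode with index `i`. -/
def charge (i : ℕ) : ℂ := 2 - 2 * (i % 3 : ℕ)

/-- The `L₀`-weight of the negative mode with index `i`. -/
def energy (i : ℕ) : ℂ := (i / 3 + 1 : ℕ)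

lemma h0_monomialBasis (A : Multiset ℕ) :
    h0 k (monomialBasis k A) = (A.map charge).sum • monomialBasis k A := by
  rw [monomialBasis_apply]
  exact weight_prod_smul (h0_vacuum k) (fun i w => h0_u_smul k _ _ w) A

lemma L0_monomialBasis (hk : k ≠ -2) (A : Multiset ℕ) :
    L0 k (monomialBasis k A) = (A.map energy).sum • monomialBasis k A := by
  rw [monomialBasis_apply]
  exact weight_prod_smul (L0_vacuum k) (fun i w => L0_u_smul k hk _ (Nat.succ_ne_zero _) w) A

end AffineSl2
end

noncomputable section

open InducedModule

/-- The ordered word in `ℕ` in which the letters `3 (i - 1)`, `3 (i - 1) + 1`, `3 (i - 1) + 2` occur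
with multiplicities `a i`, `b i`, `d i` for `1 ≤ i ≤ N`. -/
def exponentWord (N : ℕ) (a b d : ℕ → ℕ) : List ℕ :=
  (List.range' 1 N).flatMap fun i =>
    List.replicate (a i) (3 * (i - 1)) ++ List.replicate (b i) (3 * (i - 1) + 1) ++
      List.replicate (d i) (3 * (i - 1) + 2)

lemma exponentWord_succ (N : ℕ) (a b d : ℕ → ℕ) :
    exponentWord (N + 1) a b d = exponentWord N a b d ++
      (List.replicate (a (N + 1)) (3 * N) ++ List.replicate (b (N + 1)) (3 * N + 1) ++
        List.replicate (d (N + 1)) (3 * N + 2)) := by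
  simp [exponentWord, List.range'_concat, add_comm 1 N]

lemma lt_of_mem_exponentWord {N : ℕ} {a b d : ℕ → ℕ} {j : ℕ} (hj : j ∈ exponentWord N a b d) :
    j < 3 * N := by
  induction N with
  | zero => simp [exponentWord] at hj
  | succ N ih =>
    simp only [exponentWord_succ, List.mem_append, List.mem_replicate] at hj
    rcases hj with hj | (⟨-, rfl⟩ | ⟨-, rfl⟩) | ⟨-, rfl⟩
    · have := ih hj; omega
    all_goals omega

lemma pairwise_exponentWord (N : ℕ) (a b d : ℕ → ℕ) :
    (exponentWord N a b d).Pairwise (· ≤ ·) := by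
  induction N with
  | zero => simp [exponentWord]
  | succ N ih =>
    simp only [exponentWord_succ, List.pairwise_append, List.pairwise_replicate,
      List.mem_append, List.mem_replicate]
    refine ⟨ih, ⟨⟨by simp, by simp, by omega⟩, by simp, by omega⟩, fun i hi j hj => ?_⟩
    have := lt_of_mem_exponentWord hi
    omega

lemma sort_exponentWord (N : ℕ) (a b d : ℕ → ℕ) :
    (exponentWord N a b d : Multiset ℕ).sort = exponentWord N a b d :=
  List.mergeSort_eq_self _ (pairwise_exponentWord N a b d)

lemma prod_exponentWord {M : Type*} [Monoid M] (x : ℕ → M) (N : ℕ) (a b d : ℕ → ℕ) :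
    ((exponentWord N a b d).map x).prod =
      ((List.range' 1 N).map fun i => x (3 * (i - 1)) ^ a i * x (3 * (i - 1) + 1) ^ b i *
        x (3 * (i - 1) + 2) ^ d i).prod := by
  rw [exponentWord]
  induction List.range' 1 N with
  | nil => simp
  | cons i l ih =>
    simp only [List.flatMap_cons, List.map_append, List.prod_append, List.map_replicate,
      List.prod_replicate, List.map_cons, List.prod_cons, ih]

lemma exists_exponentWord_eq (A : Multiset ℕ) :
    ∃ N a b d, (exponentWord N a b d : Multiset ℕ) = A := by
  have key : ∀ N, (exponentWord N (fun i => A.count (3 * (i - 1)))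
      (fun i => A.count (3 * (i - 1) + 1)) (fun i => A.count (3 * (i - 1) + 2)) : Multiset ℕ) =
      A.filter (· < 3 * N) := by
    intro N
    induction N with
    | zero => simp [exponentWord]
    | succ N ih =>
      rw [exponentWord_succ, ← Multiset.coe_add, ih]
      ext j
      simp only [Multiset.count_add, Multiset.coe_count, List.count_append, List.count_replicate,
        Multiset.count_filter, Nat.add_sub_cancel, beq_iff_eq]
      rcases lt_or_ge j (3 * N) with h | h
      · rw [if_pos h, if_neg (by omega), if_neg (by omega), if_neg (by omega), if_pos (by omega)]
        rfl
      rcases lt_or_ge j (3 * (N + 1)) with h' | h'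
      · obtain rfl | rfl | rfl : j = 3 * N ∨ j = 3 * N + 1 ∨ j = 3 * N + 2 := by omega
        all_goals simp
        all_goals omega
      · rw [if_neg (by omega), if_neg (by omega), if_neg (by omega), if_neg (by omega),
          if_neg (by omega)]
  refine ⟨A.sup + 1, _, _, _, (key _).trans (Multiset.filter_eq_self.mpr fun j hj => ?_)⟩
  have := Multiset.le_sup hj
  omega

lemma AffineSl2.monomial_eq (k : ℂ) (N : ℕ) (a b d : ℕ → ℕ) :
    AffineSl2.monomial k N a b d = AffineSl2.monomialBasis k (exponentWord N a b d) := by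
  rw [AffineSl2.monomialBasis_apply, sort_exponentWord, prod_exponentWord, AffineSl2.monomial]
  congr 2
  refine List.map_congr_left fun i hi => ?_
  obtain ⟨i, rfl⟩ : ∃ j, i = j + 1 := ⟨i - 1, by simp at hi; omega⟩
  have h0 : AffineSl2.residue (3 * i) = 0 := Fin.ext (by simp [AffineSl2.residue])
  have h1 : AffineSl2.residue (3 * i + 1) = 1 := Fin.ext (by simp [AffineSl2.residue])
  have h2 : AffineSl2.residue (3 * i + 2) = 2 := Fin.ext (by simp [AffineSl2.residue])
  rw [Nat.add_sub_cancel, h0, h1, h2, show 3 * i / 3 + 1 = i + 1 by omega,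
    show (3 * i + 1) / 3 + 1 = i + 1 by omega, show (3 * i + 2) / 3 + 1 = i + 1 by omega]
  rfl

lemma Virasoro.monomial_eq (c : ℂ) (ε : ℤˣ) (N : ℕ) (a b d : ℕ → ℕ) :
    Virasoro.monomial c ε N a b d = Virasoro.monomialBasis c ε (exponentWord N a b d) := by
  rw [Virasoro.monomialBasis_apply, sort_exponentWord, prod_exponentWord, Virasoro.monomial]
  congr 2
  refine List.map_congr_left fun i hi => ?_
  obtain ⟨i, rfl⟩ : ∃ j, i = j + 1 := ⟨i - 1, by simp at hi; omega⟩
  have h0 : -Virasoro.degree ε (3 * i) = -3 * ((i + 1 : ℕ) : ℤ) + ε := by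
    rw [Virasoro.degree, show 3 * i / 3 = i by omega, show 3 * i % 3 = 0 by omega]
    push_cast; ring
  have h1 : -Virasoro.degree ε (3 * i + 1) = -3 * ((i + 1 : ℕ) : ℤ) := by
    rw [Virasoro.degree, show (3 * i + 1) / 3 = i by omega, show (3 * i + 1) % 3 = 1 by omega]
    push_cast; ring
  have h2 : -Virasoro.degree ε (3 * i + 2) = -3 * ((i + 1 : ℕ) : ℤ) - ε := by
    rw [Virasoro.degree, show (3 * i + 2) / 3 = i by omega, show (3 * i + 2) % 3 = 2 by omega]
    push_cast; ring
  rw [Nat.add_sub_cancel, h0, h1, h2]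

lemma degree_eq_charge_energy (ε : ℤˣ) (i : ℕ) :
    (Virasoro.degree ε i : ℂ) =
      -((ε : ℤ) : ℂ) / 2 * AffineSl2.charge i + 3 * AffineSl2.energy i := by
  rw [Virasoro.degree, AffineSl2.charge, AffineSl2.energy]
  generalize i / 3 = q, i % 3 = r
  push_cast; ring

lemma sum_degree_eq (ε : ℤˣ) (A : Multiset ℕ) :
    (A.map fun i => (Virasoro.degree ε i : ℂ)).sum =
      -((ε : ℤ) : ℂ) / 2 * (A.map AffineSl2.charge).sum + 3 * (A.map AffineSl2.energy).sum := by
  simp only [degree_eq_charge_energy, Multiset.sum_map_add, Multiset.sum_map_mul_left]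

lemma sum_degree_cast (ε : ℤˣ) (A : Multiset ℕ) :
    (A.map fun i => (Virasoro.degree ε i : ℂ)).sum = ((A.map (Virasoro.degree ε)).sum : ℤ) := by
  simp [Int.cast_multiset_sum]

lemma sum_energy_cast (A : Multiset ℕ) :
    (A.map AffineSl2.energy).sum = ((A.map fun i => i / 3 + 1).sum : ℕ) := by
  rw [Nat.cast_multiset_sum, Multiset.map_map]
  rfl

lemma card_le_sum_degree (ε : ℤˣ) (A : Multiset ℕ) :
    (A.card : ℤ) ≤ (A.map (Virasoro.degree ε)).sum := by
  induction A using Multiset.induction with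
  | empty => simp
  | cons i A ih =>
    have := (Virasoro.le_degree ε i).2
    simp only [Multiset.card_cons, Multiset.map_cons, Multiset.sum_cons]
    push_cast
    omega

lemma le_sum_degree (ε : ℤˣ) {A : Multiset ℕ} {i : ℕ} (hi : i ∈ A) :
    (i : ℤ) ≤ (A.map (Virasoro.degree ε)).sum := by
  obtain ⟨B, rfl⟩ := Multiset.exists_cons_of_mem hi
  have := (Virasoro.le_degree ε i).1
  have := card_le_sum_degree ε B
  rw [Multiset.map_cons, Multiset.sum_cons]
  omega

lemma finite_sum_degree (ε : ℤˣ) (m : ℂ) :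
    {A : Multiset ℕ | (A.map fun i => (Virasoro.degree ε i : ℂ)).sum = m}.Finite := by
  by_cases hm : ∃ t : ℤ, (t : ℂ) = m
  · obtain ⟨t, rfl⟩ := hm
    refine (Set.finite_Iic (t.toNat • Multiset.range (t.toNat + 1))).subset fun A hA => ?_
    have hA : (A.map (Virasoro.degree ε)).sum = t := by
      rw [Set.mem_ofPred_eq, sum_degree_cast] at hA
      exact_mod_cast hA
    rw [Set.mem_Iic, Multiset.le_iff_count]
    intro i
    by_cases hi : i ∈ A
    · have h1 := card_le_sum_degree ε A
      have h2 := le_sum_degree ε hi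
      have h3 := Multiset.count_le_card i A
      rw [Multiset.count_nsmul, Multiset.count_eq_one_of_mem (Multiset.nodup_range _)
        (Multiset.mem_range.mpr (by omega))]
      omega
    · rw [Multiset.count_eq_zero_of_notMem hi]
      exact Nat.zero_le _
  · refine Set.finite_empty.subset fun A hA => hm ?_
    rw [Set.mem_ofPred_eq, sum_degree_cast] at hA
    exact ⟨_, hA⟩

theorem mainTheorem6 (k c : ℂ) (hk : k ≠ -2) (ε : ℤˣ) :
    (∃ ψ : AffineSl2.UniversalVOA k ≃ₗ[ℂ] Virasoro.UniversalVOA c,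
      (∀ (N : ℕ) (a b d : ℕ → ℕ),
        ψ (AffineSl2.monomial k N a b d) = Virasoro.monomial c ε N a b d) ∧
      (∀ φ : AffineSl2.UniversalVOA k →ₗ[ℂ] Virasoro.UniversalVOA c,
        (∀ (N : ℕ) (a b d : ℕ → ℕ),
          φ (AffineSl2.monomial k N a b d) = Virasoro.monomial c ε N a b d) → φ = ψ) ∧
      (∀ (f n : ℂ) (v : AffineSl2.UniversalVOA k),
        AffineSl2.h0 k v = f • v → AffineSl2.L0 k v = n • v →
        Virasoro.L0 c (ψ v) = (-((ε : ℤ) : ℂ) * f / 2 + 3 * n) • ψ v)) ∧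
    FormalCharacter.HasJacobiChar (AffineSl2.h0 k) (AffineSl2.L0 k) ∧
    FormalCharacter.HasChar (Virasoro.L0 c) ∧
    FormalCharacter.CanSubst
      (FormalCharacter.jacobiChar (AffineSl2.h0 k) (AffineSl2.L0 k)) (-((ε : ℤ) : ℂ) / 2) 3 ∧
    FormalCharacter.subst
      (FormalCharacter.jacobiChar (AffineSl2.h0 k) (AffineSl2.L0 k)) (-((ε : ℤ) : ℂ) / 2) 3 =
      FormalCharacter.char (Virasoro.L0 c) := by
  have hH := AffineSl2.h0_monomialBasis k
  have hL := AffineSl2.L0_monomialBasis k hk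
  have hV := Virasoro.L0_monomialBasis c ε
  set w : Multiset ℕ → ℂ × ℂ :=
    fun A => ((A.map AffineSl2.charge).sum, (A.map AffineSl2.energy).sum) with hw
  have hfin : ∀ m, {A | -((ε : ℤ) : ℂ) / 2 * (w A).1 + 3 * (w A).2 = m}.Finite := fun m => by
    simpa only [sum_degree_eq] using finite_sum_degree ε m
  have hJ : FormalCharacter.jacobiChar (AffineSl2.h0 k) (AffineSl2.L0 k) =
      FormalCharacter.fiberCount w :=
    funext (FormalCharacter.jacobiChar_of_diagonal hH hL)
  refine ⟨⟨(AffineSl2.monomialBasis k).equiv (Virasoro.monomialBasis c ε) (Equiv.refl _),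
    fun N a b d => ?_, fun φ hφ => ?_, fun f n v hf hn => ?_⟩, ?_, ?_, ?_, ?_⟩
  · rw [AffineSl2.monomial_eq, Virasoro.monomial_eq, Module.Basis.equiv_apply, Equiv.refl_apply]
  · refine (AffineSl2.monomialBasis k).ext fun A => ?_
    obtain ⟨N, a, b, d, rfl⟩ := exists_exponentWord_eq A
    rw [← AffineSl2.monomial_eq, hφ, Virasoro.monomial_eq, AffineSl2.monomial_eq,
      LinearEquiv.coe_coe, Module.Basis.equiv_apply, Equiv.refl_apply]
  · set ψ := (AffineSl2.monomialBasis k).equiv (Virasoro.monomialBasis c ε) (Equiv.refl _)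
    have key : (Virasoro.L0 c).comp ψ.toLinearMap = ψ.toLinearMap.comp
        ((-((ε : ℤ) : ℂ) / 2) • AffineSl2.h0 k + (3 : ℂ) • AffineSl2.L0 k) := by
      refine (AffineSl2.monomialBasis k).ext fun A => ?_
      simp only [LinearMap.comp_apply, LinearEquiv.coe_coe, LinearMap.add_apply,
        LinearMap.smul_apply, hH, hL, map_add, map_smul, ψ, Module.Basis.equiv_apply,
        Equiv.refl_apply, hV, sum_degree_eq]
      module
    have := LinearMap.congr_fun key v
    simp only [LinearMap.comp_apply, LinearEquiv.coe_coe, LinearMap.add_apply,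
      LinearMap.smul_apply, hf, hn, map_add, map_smul] at this
    rw [this]
    module
  · refine FormalCharacter.hasJacobiChar_of_diagonal hH hL (fun p => ?_) (B := 0) fun A => ?_
    · exact (hfin (-((ε : ℤ) : ℂ) / 2 * p.1 + 3 * p.2)).subset fun A hA => by
        rw [Set.mem_ofPred_eq] at hA ⊢
        rw [← hA]
    · rw [sum_energy_cast, Complex.natCast_re]
      exact Nat.cast_nonneg _
  · refine FormalCharacter.hasChar_of_diagonal hV (finite_sum_degree ε) (B := 0) fun A => ?_
    rw [sum_degree_cast, Complex.intCast_re]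
    exact_mod_cast (Nat.cast_nonneg A.card).trans (card_le_sum_degree ε A)
  · rw [hJ]
    exact FormalCharacter.canSubst_fiberCount w _ _ hfin
  · funext m
    rw [hJ, FormalCharacter.subst_fiberCount w _ _ m (hfin m),
      FormalCharacter.char_of_diagonal hV]
    simp only [sum_degree_eq, hw]

end
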